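/- Let $k$ be an algebraically closed field. Let $Q_1$ be the quiver with three vertices $b$, $mid$, $e$ and exactly three arrows $b\to e$, $b\to mid$, $mid\to e$ (no relations), and let $Rep_k(Q_1)$ be the category of finite-dimensional representations of $Q_1$ over $k$. An object $X$ of $Rep_k(Q_1)$ is called exceptional if $\dim_k \mathrm{Hom}(X,X)=1$ and $\mathrm{Ext}^i(X,X)=0$ for all $i\ge 1$. For $m\ge 0$ define the linear maps $\pi_\pm^m:k^{m+1}\to k^m$ and $j_\pm^m:k^m\to k^{m+1}$ by $$\pi_+^m(a_1,\dots,a_{m+1})=(a_1,\dots,a_m),\qquad \pi_-^m(a_1,\dots,a_{m+1})=(a_2,\dots,a_{m+1}),$$ $$j_+^m(a_1,\dots,a_m)=(a_1,\dots,a_m,0),\qquad j_-^m(a_1,\dots,a_m)=(0,a_1,\dots,a_m)$$ (for $m=0$ these are the zero maps $k\to 0$ and $0\to k$). Write $(V_b,V_{mid},V_e;\,f,g,h)$ for the representation with the given spaces at the vertices and the maps $f:V_b\to V_e$, $g:V_b\to V_{mid}$, $h:V_{mid}\to V_e$. Put, for $m\ge 0$, $$E_1^m=(k^{m+1},k^m,k^m;\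 \pi_+^m,\pi_-^m,\mathrm{Id}),\qquad E_2^m=(k^m,k^{m+1},k^{m+1};\ j_+^m,j_-^m,\mathrm{Id}),$$ $$E_3^m=(k^m,k^m,k^{m+1};\ j_+^m,\mathrm{Id},j_-^m),\qquad E_4^m=(k^{m+1},k^{m+1},k^m;\ \pi_+^m,\mathrm{Id},\pi_-^m),$$ $$M=(0,k,0;\ 0,0,0),\qquad M'=(k,0,k;\ \mathrm{Id},0,0).$$ Then an object of $Rep_k(Q_1)$ is exceptional if and only if it is isomorphic to one of $E_1^m,E_2^m,E_3^m,E_4^m$ $(m=0,1,2,\dots)$, $M$, $M'$; and these listed objects are pairwise non-isomorphic. -/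

import Mathlib

open CategoryTheory

universe u v w

/-! ### Quiver representations and exceptional objects -/

/-- The category `Rep_k(Q)` of finite-dimensional representations over `k` of a quiver `Q`: a
representation is a functor from the free (path) category on `Q` to finite-dimensional
`k`-vector spaces, that is, a finite-dimensional space for each vertex and an arbitrary linear
map for each arrow. Morphisms are natural transformations. -/
abbrev QuiverRep (k : Type u) [Field k] (Q : Type v) [Quiver.{w} Q] :=
  Paths Q ⥤ FGModuleCat.{u} k

/-- An object `X` of a `k`-linear abelian category is exceptional if `Hom(X, X) = k`, that is
`dim_k Hom(X, X) = 1`, and `Ext^i(X, X) = 0` for all `i ≥ 1`. (For `i < 0` there is nothing to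
require, since negative Ext groups between objects of an abelian category vanish.)
The groups `Ext^i` are the morphism groups `Hom(X, X[i])` in the derived category. -/
def IsExceptional (k : Type*) [Field k] {C : Type v} [Category.{w} C] [Abelian C] [Linear k C]
    (X : C) : Prop :=
  Module.finrank k (X ⟶ X) = 1 ∧
    haveI : HasExt.{max v w} C := HasExt.standard C
    ∀ i : ℕ, 1 ≤ i → Subsingleton (Abelian.Ext.{max v w} X X i)

/-! ### The quiver `Q₁` -/

/-- The three vertices (begin, middle, end) of the quiver `Q₁`. -/
inductive QOne : Type
  | b
  | mid
  | e

/-- The three arrows `b ⟶ e`, `b ⟶ mid`, `mid ⟶ e` of the quiver `Q₁`. -/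
inductive QOne.Arrow : QOne → QOne → Type
  | be : QOne.Arrow QOne.b QOne.e
  | bmid : QOne.Arrow QOne.b QOne.mid
  | mide : QOne.Arrow QOne.mid QOne.e

instance : Quiver QOne where
  Hom := QOne.Arrow

section Construction

variable (k : Type u) [Field k]

/-- The space at each vertex for the representation `QOne.mkRep`. -/
def QOne.space (Vb Vmid Ve : FGModuleCat.{u} k) : QOne → FGModuleCat.{u} k
  | .b => Vb
  | .mid => Vmid
  | .e => Ve

/-- The map at each arrow for the representation `QOne.mkRep`. -/
def QOne.arrowMap {Vb Vmid Ve : FGModuleCat.{u} k}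
    (f : Vb ⟶ Ve) (g : Vb ⟶ Vmid) (h : Vmid ⟶ Ve) :
    {x y : QOne} → QOne.Arrow x y → (QOne.space k Vb Vmid Ve x ⟶ QOne.space k Vb Vmid Ve y)
  | _, _, .be => f
  | _, _, .bmid => g
  | _, _, .mide => h

/-- The representation of `Q₁` with spaces `Vb`, `Vmid`, `Ve` at the vertices and with linear maps
`f : Vb → Ve`, `g : Vb → Vmid`, `h : Vmid → Ve` at the arrows. -/
def QOne.mkRep {Vb Vmid Ve : Type u}
    [AddCommGroup Vb] [Module k Vb] [Module.Finite k Vb]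
    [AddCommGroup Vmid] [Module k Vmid] [Module.Finite k Vmid]
    [AddCommGroup Ve] [Module k Ve] [Module.Finite k Ve]
    (f : Vb →ₗ[k] Ve) (g : Vb →ₗ[k] Vmid) (h : Vmid →ₗ[k] Ve) : QuiverRep k QOne :=
  Paths.lift
    { obj := QOne.space k (FGModuleCat.of k Vb) (FGModuleCat.of k Vmid) (FGModuleCat.of k Ve)
      map := QOne.arrowMap k (FGModuleCat.ofHom f) (FGModuleCat.ofHom g) (FGModuleCat.ofHom h) }

/-- `π₊ᵐ (a₁, …, aₘ, aₘ₊₁) = (a₁, …, aₘ)` -/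
def piPlus (m : ℕ) : (Fin (m + 1) → k) →ₗ[k] (Fin m → k) where
  toFun a := fun i => a i.castSucc
  map_add' _ _ := rfl
  map_smul' _ _ := rfl

/-- `π₋ᵐ (a₁, …, aₘ, aₘ₊₁) = (a₂, …, aₘ₊₁)` -/
def piMinus (m : ℕ) : (Fin (m + 1) → k) →ₗ[k] (Fin m → k) where
  toFun a := fun i => a i.succ
  map_add' _ _ := rfl
  map_smul' _ _ := rfl

/-- `j₊ᵐ (a₁, …, aₘ) = (a₁, …, aₘ, 0)` -/
def jPlus (m : ℕ) : (Fin m → k) →ₗ[k] (Fin (m + 1) → k) where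
  toFun a := Fin.snoc (α := fun _ => k) a 0
  map_add' a b := by
    ext i
    refine Fin.lastCases ?_ (fun i => ?_) i <;> simp
  map_smul' c a := by
    ext i
    refine Fin.lastCases ?_ (fun i => ?_) i <;> simp

/-- `j₋ᵐ (a₁, …, aₘ) = (0, a₁, …, aₘ)` -/
def jMinus (m : ℕ) : (Fin m → k) →ₗ[k] (Fin (m + 1) → k) where
  toFun a := Fin.cons (α := fun _ => k) 0 a
  map_add' a b := by
    ext i
    refine Fin.cases ?_ (fun i => ?_) i <;> simp
  map_smul' c a := by
    ext i
    refine Fin.cases ?_ (fun i => ?_) i <;> simp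

namespace QOne

/-- `E₁ᵐ`: spaces `(k^(m+1), k^m, k^m)` at `(b, mid, e)`. -/
def E₁ (m : ℕ) : QuiverRep k QOne :=
  mkRep k (f := piPlus k m) (g := piMinus k m) (h := LinearMap.id)

/-- `E₂ᵐ`: spaces `(k^m, k^(m+1), k^(m+1))` at `(b, mid, e)`. -/
def E₂ (m : ℕ) : QuiverRep k QOne :=
  mkRep k (f := jPlus k m) (g := jMinus k m) (h := LinearMap.id)

/-- `E₃ᵐ`: spaces `(k^m, k^m, k^(m+1))` at `(b, mid, e)`. -/
def E₃ (m : ℕ) : QuiverRep k QOne :=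
  mkRep k (f := jPlus k m) (g := LinearMap.id) (h := jMinus k m)

/-- `E₄ᵐ`: spaces `(k^(m+1), k^(m+1), k^m)` at `(b, mid, e)`. -/
def E₄ (m : ℕ) : QuiverRep k QOne :=
  mkRep k (f := piPlus k m) (g := LinearMap.id) (h := piMinus k m)

/-- `M`: spaces `(0, k, 0)` at `(b, mid, e)`. -/
def M : QuiverRep k QOne :=
  mkRep k (Vb := PUnit) (Vmid := k) (Ve := PUnit) (f := 0) (g := 0) (h := 0)

/-- `M'`: spaces `(k, 0, k)` at `(b, mid, e)`, with the identity at the arrow `b ⟶ e`. -/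
def MPrime : QuiverRep k QOne :=
  mkRep k (Vb := k) (Vmid := PUnit) (Ve := k) (f := LinearMap.id) (g := 0) (h := 0)

/-- Labels for the entries of the list `E₁ᵐ, E₂ᵐ, E₃ᵐ, E₄ᵐ` (`m = 0, 1, 2, …`), `M`, `M'`. -/
inductive Label : Type
  | E₁ (m : ℕ)
  | E₂ (m : ℕ)
  | E₃ (m : ℕ)
  | E₄ (m : ℕ)
  | M
  | MPrime

/-- The list `E₁ᵐ, E₂ᵐ, E₃ᵐ, E₄ᵐ` (`m = 0, 1, 2, …`), `M`, `M'` of representations of `Q₁`. -/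
def listed : Label → QuiverRep k QOne
  | .E₁ m => QOne.E₁ k m
  | .E₂ m => QOne.E₂ k m
  | .E₃ m => QOne.E₃ k m
  | .E₄ m => QOne.E₄ k m
  | .M => QOne.M k
  | .MPrime => QOne.MPrime k

end QOne

end Construction

/-! A representation of `Q₁` has a projective resolution of length one, so `Ext^i` vanishes for `i ≥
2`, and `Hom(X, X)` and `Ext¹(X, X)` are the kernel and cokernel of the single linear map
`tripleMap` (`isExceptional_iff`). When the kernel is a line, vanishing of the cokernel is the
numerical condition that the Euler form takes the value 1 at the dimension vector. That form depends
only on the differences `x - y` and `y - z`, where it is positive definite, so just six families of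
dimension vectors remain (`eq_dimension_vectors`).

Rigidity makes every arrow injective or surjective. In four families this inverts `g` or `h`;
contracting that arrow leaves a rigid Kronecker module of dimension `(m + 1, m)` or `(m, m + 1)`,
which must be the standard one (`exists_equiv_pi_of_rigid`, `exists_equiv_j_of_rigid`). In the other
two families `f` is invertible, and the loops through `f⁻¹`, `g` and `h` form an endomorphism, hence
a scalar. Unequal dimensions force it to vanish, and the ranks of `g` and `h` then leave only `M`
and `M'`.

Conversely, an endomorphism of a standard Kronecker module, shifted by an eigenvalue, has an image
and a kernel whose dimensions force it to be zero. So the listed objects have scalar endomorphisms,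
and the Euler form gives rigidity. Dimension vectors tell them apart. -/

section Kronecker

variable {k : Type u} [Field k]

/-! ### Kronecker modules: dimension counts for morphisms and extensions -/

section Pencil

variable {V W V' W' : Type*} [AddCommGroup V] [Module k V] [AddCommGroup W] [Module k W]
  [AddCommGroup V'] [Module k V'] [AddCommGroup W'] [Module k W']

/-- The map `(p, q) ↦ (q a - a' p, q b - b' p)` whose kernel is the space of morphisms between the
Kronecker modules `(a, b)` and `(a', b')`, and whose cokernel is the space of extensions. -/
def pencilMap (a b : V →ₗ[k] W) (a' b' : V' →ₗ[k] W') :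
    ((V →ₗ[k] V') × (W →ₗ[k] W')) →ₗ[k] ((V →ₗ[k] W') × (V →ₗ[k] W')) where
  toFun x := (x.2 ∘ₗ a - a' ∘ₗ x.1, x.2 ∘ₗ b - b' ∘ₗ x.1)
  map_add' x y := by
    ext <;> simp <;> abel
  map_smul' c x := by
    ext <;> simp [smul_sub]

variable [FiniteDimensional k V] [FiniteDimensional k W] [FiniteDimensional k V']
  [FiniteDimensional k W']

/-- The hypothesis says that the Euler form of the pair is positive, so `pencilMap` cannot be
injective. -/
lemma exists_pencil_hom_ne_zero (a b : V →ₗ[k] W) (a' b' : V' →ₗ[k] W')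
    (h : 2 * (Module.finrank k V * Module.finrank k W') <
      Module.finrank k V * Module.finrank k V' + Module.finrank k W * Module.finrank k W') :
    ∃ (p : V →ₗ[k] V') (q : W →ₗ[k] W'), q ∘ₗ a = a' ∘ₗ p ∧ q ∘ₗ b = b' ∘ₗ p ∧
      ¬ (p = 0 ∧ q = 0) := by
  have hk : LinearMap.ker (pencilMap a b a' b') ≠ ⊥ := by
    apply LinearMap.ker_ne_bot_of_finrank_lt
    simp only [Module.finrank_prod, Module.finrank_linearMap]
    omega
  obtain ⟨⟨p, q⟩, hx, hne⟩ := Submodule.exists_mem_ne_zero_of_ne_bot hk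
  simp only [pencilMap, LinearMap.mem_ker, LinearMap.coe_mk, AddHom.coe_mk, Prod.mk_eq_zero,
    sub_eq_zero] at hx
  exact ⟨p, q, hx.1, hx.2, fun h0 => hne (by simp [h0.1, h0.2])⟩

/-- Without extensions the Euler form equals the dimension of the space of morphisms, which is
positive once a nonzero morphism exists. -/
lemma finrank_lt_of_pencilMap_surjective (a b : V →ₗ[k] W) (a' b' : V' →ₗ[k] W')
    (hs : Function.Surjective (pencilMap a b a' b'))
    (p : V →ₗ[k] V') (q : W →ₗ[k] W') (ha : q ∘ₗ a = a' ∘ₗ p) (hb : q ∘ₗ b = b' ∘ₗ p)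
    (hne : ¬ (p = 0 ∧ q = 0)) :
    2 * (Module.finrank k V * Module.finrank k W') <
      Module.finrank k V * Module.finrank k V' + Module.finrank k W * Module.finrank k W' := by
  have h1 := (pencilMap a b a' b').finrank_range_add_finrank_ker
  rw [LinearMap.range_eq_top.2 hs, finrank_top] at h1
  have h2 : 0 < Module.finrank k (LinearMap.ker (pencilMap a b a' b')) := by
    rw [Module.finrank_pos_iff_exists_ne_zero]
    refine ⟨⟨(p, q), ?_⟩, fun h0 => hne ?_⟩
    · simp [pencilMap, ha, hb]
    · simpa using congrArg Subtype.val h0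
  simp only [Module.finrank_prod, Module.finrank_linearMap] at h1
  omega

omit [FiniteDimensional k V'] [FiniteDimensional k W'] in
/-- Extensions of a quotient of a rigid Kronecker module `(a, b)` by `(a, b)`. -/
lemma finrank_range_lt_of_rigid_source (a b : V →ₗ[k] W)
    (hs : Function.Surjective (pencilMap a b a b)) (a' b' : V' →ₗ[k] W')
    (p : V →ₗ[k] V') (q : W →ₗ[k] W') (ha : q ∘ₗ a = a' ∘ₗ p) (hb : q ∘ₗ b = b' ∘ₗ p)
    (hne : ¬ (p = 0 ∧ q = 0)) :
    2 * (Module.finrank k V * Module.finrank k (LinearMap.range q)) <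
      Module.finrank k V * Module.finrank k (LinearMap.range p) +
      Module.finrank k W * Module.finrank k (LinearMap.range q) := by
  have hma : ∀ x ∈ LinearMap.range p, a' x ∈ LinearMap.range q := by
    rintro _ ⟨x, rfl⟩
    exact ⟨a x, LinearMap.congr_fun ha x⟩
  have hmb : ∀ x ∈ LinearMap.range p, b' x ∈ LinearMap.range q := by
    rintro _ ⟨x, rfl⟩
    exact ⟨b x, LinearMap.congr_fun hb x⟩
  have ha' : q.rangeRestrict ∘ₗ a = a'.restrict hma ∘ₗ p.rangeRestrict := by
    ext x
    exact LinearMap.congr_fun ha x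
  have hb' : q.rangeRestrict ∘ₗ b = b'.restrict hmb ∘ₗ p.rangeRestrict := by
    ext x
    exact LinearMap.congr_fun hb x
  refine finrank_lt_of_pencilMap_surjective a b (a'.restrict hma) (b'.restrict hmb) ?_
    p.rangeRestrict q.rangeRestrict ha' hb' ?_
  · rintro ⟨φ, ψ⟩
    -- Right exactness of `Ext¹` in the second variable: lift the cocycle through a section of `q`,
    -- trivialize it there by rigidity, and push the solution down to the image.
    obtain ⟨s, hsec⟩ := q.rangeRestrict.exists_rightInverse_of_surjective q.range_rangeRestrict
    obtain ⟨⟨α, ε⟩, h⟩ := hs (s ∘ₗ φ, s ∘ₗ ψ)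
    simp only [pencilMap, LinearMap.coe_mk, AddHom.coe_mk, Prod.mk.injEq] at h
    refine ⟨(p.rangeRestrict ∘ₗ α, q.rangeRestrict ∘ₗ ε), ?_⟩
    simp only [pencilMap, LinearMap.coe_mk, AddHom.coe_mk, Prod.mk.injEq]
    rw [← LinearMap.comp_assoc α, ← LinearMap.comp_assoc α, ← ha', ← hb',
      LinearMap.comp_assoc, LinearMap.comp_assoc, LinearMap.comp_assoc, LinearMap.comp_assoc,
      ← LinearMap.comp_sub, ← LinearMap.comp_sub, h.1, h.2, ← LinearMap.comp_assoc,
      ← LinearMap.comp_assoc, hsec]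
    simp
  · rintro ⟨h1, h2⟩
    refine hne ⟨?_, ?_⟩
    · ext x; exact congrArg Subtype.val (LinearMap.congr_fun h1 x)
    · ext x; exact congrArg Subtype.val (LinearMap.congr_fun h2 x)

/-- Extensions of a rigid Kronecker module `(a, b)` by a submodule of `(a, b)`. -/
lemma finrank_range_lt_of_rigid_target (a b : V →ₗ[k] W)
    (hs : Function.Surjective (pencilMap a b a b)) (a' b' : V' →ₗ[k] W')
    (p : V' →ₗ[k] V) (q : W' →ₗ[k] W) (ha : q ∘ₗ a' = a ∘ₗ p) (hb : q ∘ₗ b' = b ∘ₗ p)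
    (hne : ¬ (p = 0 ∧ q = 0)) :
    2 * (Module.finrank k (LinearMap.range p) * Module.finrank k W) <
      Module.finrank k (LinearMap.range p) * Module.finrank k V +
      Module.finrank k (LinearMap.range q) * Module.finrank k W := by
  have hma : ∀ x ∈ LinearMap.range p, a x ∈ LinearMap.range q := by
    rintro _ ⟨x, rfl⟩
    exact ⟨a' x, LinearMap.congr_fun ha x⟩
  have hmb : ∀ x ∈ LinearMap.range p, b x ∈ LinearMap.range q := by
    rintro _ ⟨x, rfl⟩
    exact ⟨b' x, LinearMap.congr_fun hb x⟩
  refine finrank_lt_of_pencilMap_surjective (a.restrict hma) (b.restrict hmb) a b ?_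
    (LinearMap.range p).subtype (LinearMap.range q).subtype rfl rfl ?_
  · rintro ⟨φ, ψ⟩
    -- The dual argument: extend the cocycle to all of `V` along a retraction, solve, and restrict.
    obtain ⟨r, hr⟩ := (LinearMap.range p).subtype.exists_leftInverse_of_injective
      (Submodule.ker_subtype _)
    obtain ⟨⟨α, ε⟩, h⟩ := hs (φ ∘ₗ r, ψ ∘ₗ r)
    simp only [pencilMap, LinearMap.coe_mk, AddHom.coe_mk, Prod.mk.injEq] at h
    refine ⟨(α ∘ₗ (LinearMap.range p).subtype, ε ∘ₗ (LinearMap.range q).subtype), ?_⟩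
    have hr' : ∀ x, r ((LinearMap.range p).subtype x) = x := LinearMap.congr_fun hr
    simp only [pencilMap, LinearMap.coe_mk, AddHom.coe_mk, Prod.mk.injEq]
    constructor
    · ext x
      have := LinearMap.congr_fun h.1 ((LinearMap.range p).subtype x)
      simp only [LinearMap.comp_apply, hr'] at this
      exact this
    · ext x
      have := LinearMap.congr_fun h.2 ((LinearMap.range p).subtype x)
      simp only [LinearMap.comp_apply, hr'] at this
      exact this
  · rintro ⟨h1, h2⟩
    refine hne ⟨?_, ?_⟩
    · ext x; exact LinearMap.congr_fun h1 (p.rangeRestrict x)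
    · ext x; exact LinearMap.congr_fun h2 (q.rangeRestrict x)

end Pencil

/-! ### Subobjects of the standard Kronecker modules -/

variable (k) in
lemma piPlus_surjective (m : ℕ) : Function.Surjective (piPlus k m) := fun y =>
  ⟨Fin.snoc (α := fun _ => k) y 0, by ext i; simp [piPlus]⟩

/-- The kernel of `piPlus` is spanned by the last basis vector. The dimension gap puts that vector
in `Y₁` and makes `piPlus : Y₁ → Y₂` onto. Applying `piMinus` and then lifting along `piPlus` moves
from each basis vector to the preceding one. -/
lemma eq_top_of_piPlus_piMinus {m : ℕ} (Y₁ : Submodule k (Fin (m + 1) → k))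
    (Y₂ : Submodule k (Fin m → k)) (hp : Y₁ ≤ Y₂.comap (piPlus k m))
    (hm : Y₁ ≤ Y₂.comap (piMinus k m)) (h : Module.finrank k Y₂ < Module.finrank k Y₁) :
    Y₁ = ⊤ := by
  set r : Y₁ →ₗ[k] Y₂ := (piPlus k m).restrict hp
  have hker : ∀ y : Fin (m + 1) → k, piPlus k m y = 0 →
      y = y (Fin.last m) • (Pi.single (Fin.last m) 1 : Fin (m + 1) → k) := by
    intro y hy
    ext i
    refine Fin.lastCases ?_ (fun i => ?_) i
    · simp
    · simpa [piPlus, Fin.castSucc_ne_last] using congrFun hy i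
  have hlast : (Pi.single (Fin.last m) 1 : Fin (m + 1) → k) ∈ Y₁ := by
    obtain ⟨y, hy, hy0⟩ := Submodule.exists_mem_ne_zero_of_ne_bot
      (LinearMap.ker_ne_bot_of_finrank_lt (f := r) h)
    have hy' := hker y (congrArg Subtype.val hy)
    have hc : (y : Fin (m + 1) → k) (Fin.last m) ≠ 0 := by
      intro hc
      rw [hc, zero_smul] at hy'
      exact hy0 (Subtype.ext hy')
    have := Y₁.smul_mem ((y : Fin (m + 1) → k) (Fin.last m))⁻¹ y.2
    rwa [hy', smul_smul, Pi.smul_apply, Pi.single_eq_same, smul_eq_mul, mul_one,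
      inv_mul_cancel₀ hc, one_smul] at this
  -- The kernel of `r` is at most a line, so its rank is at least `dim Y₁ - 1 ≥ dim Y₂`.
  have hsurj : Function.Surjective r := by
    have h1 := r.finrank_range_add_finrank_ker
    have h2 : Module.finrank k (LinearMap.ker r) ≤ Module.finrank k k :=
      LinearMap.finrank_le_finrank_of_injective
        (f := LinearMap.proj (Fin.last m) ∘ₗ Y₁.subtype ∘ₗ (LinearMap.ker r).subtype) (by
          rw [injective_iff_map_eq_zero]
          rintro ⟨y, hy⟩ h0
          have hy' := hker y (congrArg Subtype.val hy)
          have h0' : (y : Fin (m + 1) → k) (Fin.last m) = 0 := h0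
          rw [h0', zero_smul] at hy'
          exact Subtype.ext (Subtype.ext hy'))
    rw [Module.finrank_self] at h2
    rw [← LinearMap.range_eq_top]
    apply Submodule.eq_top_of_finrank_eq
    have := Submodule.finrank_le (LinearMap.range r)
    omega
  have hbasis : ∀ i : Fin (m + 1), (Pi.single i 1 : Fin (m + 1) → k) ∈ Y₁ := by
    intro i
    induction i using Fin.reverseInduction with
    | last => exact hlast
    | cast i ih =>
      have h1 : (Pi.single i 1 : Fin m → k) ∈ Y₂ := by
        have h0 : piMinus k m (Pi.single i.succ 1) = Pi.single i 1 := by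
          ext j
          simp [piMinus, Pi.single_apply]
        exact h0 ▸ hm ih
      obtain ⟨y, hy⟩ := hsurj ⟨_, h1⟩
      have hy' : piPlus k m y = Pi.single i 1 := congrArg Subtype.val hy
      -- The lift `y` agrees with the wanted basis vector up to a multiple of the last one, which
      -- already lies in `Y₁`.
      have h2 : piPlus k m ((y : Fin (m + 1) → k) - Pi.single i.castSucc 1) = 0 := by
        rw [map_sub, hy', sub_eq_zero]
        ext j
        simp [piPlus, Pi.single_apply]
      have h3 := hker _ h2
      have h4 : (Pi.single i.castSucc 1 : Fin (m + 1) → k) =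
          (y : Fin (m + 1) → k) - ((y : Fin (m + 1) → k) - Pi.single i.castSucc 1) := by abel
      rw [h4, h3]
      exact Y₁.sub_mem y.2 (Y₁.smul_mem _ hlast)
  rw [eq_top_iff, ← (Pi.basisFun k (Fin (m + 1))).span_eq, Submodule.span_le]
  rintro _ ⟨i, rfl⟩
  simpa using hbasis i

/-- As `jMinus` is injective, the dimension bound gives `K₂ = jMinus K₁`. Each `x` in `K₁` then
satisfies `jPlus x = jMinus y` with `y` in `K₁`: the first coordinate of `x` is zero and every later
one is the preceding coordinate of `y`. -/
lemma eq_bot_of_jPlus_jMinus {m : ℕ} (K₁ : Submodule k (Fin m → k))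
    (K₂ : Submodule k (Fin (m + 1) → k)) (hp : K₁ ≤ K₂.comap (jPlus k m))
    (hm : K₁ ≤ K₂.comap (jMinus k m)) (h : Module.finrank k K₂ ≤ Module.finrank k K₁) :
    K₁ = ⊥ := by
  have h2 : K₁.map (jMinus k m) = K₂ := by
    apply Submodule.eq_of_le_of_finrank_le (Submodule.map_le_iff_le_comap.2 hm)
    rwa [(Submodule.equivMapOfInjective (jMinus k m) (fun x y hxy => by
      ext i
      simpa [jMinus] using congrFun hxy i.succ) K₁).symm.finrank_eq]
  -- The induction must cover all of `K₁` at once, because its step passes from `x` to another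
  -- element `y`.
  have key : ∀ n : ℕ, ∀ x ∈ K₁, ∀ i : Fin m, i.val = n → x i = 0 := by
    intro n
    induction n with
    | zero =>
      intro x hx i hi
      have := hp hx
      rw [← h2] at this
      obtain ⟨y, hy, hxy⟩ := this
      have := congrFun hxy i.castSucc
      obtain ⟨m, rfl⟩ : ∃ m', m = m' + 1 := ⟨m - 1, by have := i.2; omega⟩
      have hi0 : i = 0 := Fin.ext hi
      subst hi0
      simp [jMinus, jPlus, -Fin.castSucc_zero] at this
      simpa [Fin.castSucc_zero] using this.symm
    | succ n ih =>
      intro x hx i hi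
      have := hp hx
      rw [← h2] at this
      obtain ⟨y, hy, hxy⟩ := this
      have h3 := congrFun hxy i.castSucc
      have h4 : i.castSucc = Fin.succ ⟨n, by have := i.2; omega⟩ := Fin.ext (by simp [hi])
      have h5 : jPlus k m x i.castSucc = x i := by simp [jPlus]
      rw [h5, h4] at h3
      rw [← h3]
      exact (Fin.cons_succ (α := fun _ => k) 0 y _).trans
        (ih y hy ⟨n, by have := i.2; omega⟩ rfl)
  rw [eq_bot_iff]
  intro x hx
  rw [Submodule.mem_bot]
  ext i
  exact key _ x hx i rfl

/-! ### Uniqueness of rigid Kronecker modules of dimension `(m + 1, m)` and `(m, m + 1)` -/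

section Unique

variable {V W : Type*} [AddCommGroup V] [Module k V] [AddCommGroup W] [Module k W]
  [FiniteDimensional k V] [FiniteDimensional k W]

/-- The Euler form is 1, so there is a nonzero morphism to the standard module. For its ranks `s`,
`t`, rigidity of the source gives `(m + 2) t < (m + 1) s`, hence `t < s`, and the image is
everything by `eq_top_of_piPlus_piMinus`. -/
theorem exists_equiv_pi_of_rigid {m : ℕ} (a b : V →ₗ[k] W)
    (hs : Function.Surjective (pencilMap a b a b))
    (hV : Module.finrank k V = m + 1) (hW : Module.finrank k W = m) :
    ∃ (p : V ≃ₗ[k] (Fin (m + 1) → k)) (q : W ≃ₗ[k] (Fin m → k)),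
      q.toLinearMap ∘ₗ a = piPlus k m ∘ₗ p.toLinearMap ∧
      q.toLinearMap ∘ₗ b = piMinus k m ∘ₗ p.toLinearMap := by
  obtain ⟨p, q, ha, hb, hne⟩ := exists_pencil_hom_ne_zero a b (piPlus k m) (piMinus k m) (by
    simp only [hV, hW, Module.finrank_fin_fun]; nlinarith)
  have hlt := finrank_range_lt_of_rigid_source a b hs _ _ p q ha hb hne
  have hp : LinearMap.range p = ⊤ := by
    apply eq_top_of_piPlus_piMinus _ (LinearMap.range q)
    · rintro _ ⟨x, rfl⟩
      exact ⟨a x, LinearMap.congr_fun ha x⟩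
    · rintro _ ⟨x, rfl⟩
      exact ⟨b x, LinearMap.congr_fun hb x⟩
    · rw [hV, hW] at hlt
      by_contra hcon
      push Not at hcon
      nlinarith
  rw [LinearMap.range_eq_top] at hp
  have hq : Function.Surjective q := by
    intro y
    obtain ⟨z, rfl⟩ := piPlus_surjective k m y
    obtain ⟨x, rfl⟩ := hp z
    exact ⟨a x, LinearMap.congr_fun ha x⟩
  have hpi := (LinearMap.injective_iff_surjective_of_finrank_eq_finrank
    (f := p) (by simp [hV])).2 hp
  have hqi := (LinearMap.injective_iff_surjective_of_finrank_eq_finrank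
    (f := q) (by simp [hW])).2 hq
  exact ⟨LinearEquiv.ofBijective p ⟨hpi, hp⟩, LinearEquiv.ofBijective q ⟨hqi, hq⟩, ha, hb⟩

/-- Here the nonzero morphism starts at the standard module. Rigidity of the target gives `(m + 2) s
< (m + 1) t` for its ranks, hence `s < t`; this bounds the kernel of `q` by that of `p`, so
`eq_bot_of_jPlus_jMinus` applies. -/
theorem exists_equiv_j_of_rigid {m : ℕ} (a b : V →ₗ[k] W)
    (hs : Function.Surjective (pencilMap a b a b))
    (hV : Module.finrank k V = m) (hW : Module.finrank k W = m + 1) :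
    ∃ (p : (Fin m → k) ≃ₗ[k] V) (q : (Fin (m + 1) → k) ≃ₗ[k] W),
      q.toLinearMap ∘ₗ jPlus k m = a ∘ₗ p.toLinearMap ∧
      q.toLinearMap ∘ₗ jMinus k m = b ∘ₗ p.toLinearMap := by
  obtain ⟨p, q, ha, hb, hne⟩ := exists_pencil_hom_ne_zero (jPlus k m) (jMinus k m) a b (by
    simp only [hV, hW, Module.finrank_fin_fun]; nlinarith)
  have hlt := finrank_range_lt_of_rigid_target a b hs _ _ p q ha hb hne
  have hp1 := p.finrank_range_add_finrank_ker
  have hq1 := q.finrank_range_add_finrank_ker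
  rw [Module.finrank_fin_fun] at hp1 hq1
  have hle : Module.finrank k (LinearMap.ker q) ≤ Module.finrank k (LinearMap.ker p) := by
    rw [hV, hW] at hlt
    by_contra hcon
    push Not at hcon
    have : Module.finrank k (LinearMap.range q) ≤ Module.finrank k (LinearMap.range p) := by omega
    nlinarith
  have hp : LinearMap.ker p = ⊥ := by
    apply eq_bot_of_jPlus_jMinus _ (LinearMap.ker q) _ _ hle
    · intro x hx
      have := LinearMap.congr_fun ha x
      simp only [LinearMap.comp_apply, LinearMap.mem_ker.1 hx, map_zero] at this
      exact this
    · intro x hx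
      have := LinearMap.congr_fun hb x
      simp only [LinearMap.comp_apply, LinearMap.mem_ker.1 hx, map_zero] at this
      exact this
  have hq : LinearMap.ker q = ⊥ := by
    rw [hp, finrank_bot, Nat.le_zero, Submodule.finrank_eq_zero] at hle
    exact hle
  rw [LinearMap.ker_eq_bot] at hp hq
  have hpi := (LinearMap.injective_iff_surjective_of_finrank_eq_finrank
    (f := p) (by simp [hV])).1 hp
  have hqi := (LinearMap.injective_iff_surjective_of_finrank_eq_finrank
    (f := q) (by simp [hW])).1 hq
  exact ⟨LinearEquiv.ofBijective p ⟨hp, hpi⟩, LinearEquiv.ofBijective q ⟨hq, hqi⟩, ha, hb⟩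

end Unique

/-! ### Endomorphisms of the standard Kronecker modules -/

section Brick

variable [IsAlgClosed k]

theorem pi_endomorphism_scalar {m : ℕ} (p : (Fin (m + 1) → k) →ₗ[k] (Fin (m + 1) → k))
    (q : (Fin m → k) →ₗ[k] (Fin m → k)) (ha : q ∘ₗ piPlus k m = piPlus k m ∘ₗ p)
    (hb : q ∘ₗ piMinus k m = piMinus k m ∘ₗ p) :
    ∃ c : k, p = c • LinearMap.id ∧ q = c • LinearMap.id := by
  obtain ⟨c, hc⟩ := Module.End.exists_eigenvalue p
  obtain ⟨v, hv⟩ := hc.exists_hasEigenvector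
  set p' := p - c • LinearMap.id with hp'
  set q' := q - c • LinearMap.id with hq'
  have ha' : ∀ x, q' (piPlus k m x) = piPlus k m (p' x) := fun x => by
    simpa [hp', hq'] using LinearMap.congr_fun ha x
  have hb' : ∀ x, q' (piMinus k m x) = piMinus k m (p' x) := fun x => by
    simpa [hp', hq'] using LinearMap.congr_fun hb x
  have hv0 : p' v = 0 := by simp [hp', hv.apply_eq_smul]
  have hp1 := p'.finrank_range_add_finrank_ker
  have hq1 := q'.finrank_range_add_finrank_ker
  rw [Module.finrank_fin_fun] at hp1 hq1
  -- Otherwise `p'` would be onto, hence injective, although it kills the eigenvector. By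
  -- rank-nullity the kernel then satisfies the dimension gap of `eq_top_of_piPlus_piMinus`.
  have hY : Module.finrank k (LinearMap.range p') ≤ Module.finrank k (LinearMap.range q') := by
    by_contra hcon
    have htop := eq_top_of_piPlus_piMinus (LinearMap.range p') (LinearMap.range q')
      (by rintro _ ⟨x, rfl⟩; exact ⟨_, ha' x⟩) (by rintro _ ⟨x, rfl⟩; exact ⟨_, hb' x⟩)
      (not_le.1 hcon)
    rw [LinearMap.range_eq_top, ← LinearMap.injective_iff_surjective] at htop
    exact hv.2 (htop (by rw [hv0, map_zero]))
  have hK : LinearMap.ker p' = ⊤ := by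
    apply eq_top_of_piPlus_piMinus _ (LinearMap.ker q')
    · intro x hx
      rw [Submodule.mem_comap, LinearMap.mem_ker, ha', LinearMap.mem_ker.1 hx, map_zero]
    · intro x hx
      rw [Submodule.mem_comap, LinearMap.mem_ker, hb', LinearMap.mem_ker.1 hx, map_zero]
    · omega
  rw [LinearMap.ker_eq_top] at hK
  refine ⟨c, sub_eq_zero.1 hK, sub_eq_zero.1 ?_⟩
  refine LinearMap.ext fun y => ?_
  obtain ⟨x, rfl⟩ := piPlus_surjective k m y
  rw [← hq', ha', hK]
  simp

theorem j_endomorphism_scalar {m : ℕ} (p : (Fin m → k) →ₗ[k] (Fin m → k))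
    (q : (Fin (m + 1) → k) →ₗ[k] (Fin (m + 1) → k)) (ha : q ∘ₗ jPlus k m = jPlus k m ∘ₗ p)
    (hb : q ∘ₗ jMinus k m = jMinus k m ∘ₗ p) :
    ∃ c : k, p = c • LinearMap.id ∧ q = c • LinearMap.id := by
  -- The eigenvalue is taken from `q`, since the space of `p` is zero when `m = 0`.
  obtain ⟨c, hc⟩ := Module.End.exists_eigenvalue q
  obtain ⟨v, hv⟩ := hc.exists_hasEigenvector
  set p' := p - c • LinearMap.id with hp'
  set q' := q - c • LinearMap.id with hq'
  have ha' : ∀ x, q' (jPlus k m x) = jPlus k m (p' x) := fun x => by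
    simpa [hp', hq'] using LinearMap.congr_fun ha x
  have hb' : ∀ x, q' (jMinus k m x) = jMinus k m (p' x) := fun x => by
    simpa [hp', hq'] using LinearMap.congr_fun hb x
  have hv0 : q' v = 0 := by simp [hq', hv.apply_eq_smul]
  have hp1 := p'.finrank_range_add_finrank_ker
  have hq1 := q'.finrank_range_add_finrank_ker
  rw [Module.finrank_fin_fun] at hp1 hq1
  have hK : Module.finrank k (LinearMap.ker p') < Module.finrank k (LinearMap.ker q') := by
    by_contra hcon
    rw [not_lt] at hcon
    have hbot := eq_bot_of_jPlus_jMinus (LinearMap.ker p') (LinearMap.ker q')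
      (by
        intro x hx
        rw [Submodule.mem_comap, LinearMap.mem_ker, ha', LinearMap.mem_ker.1 hx, map_zero])
      (by
        intro x hx
        rw [Submodule.mem_comap, LinearMap.mem_ker, hb', LinearMap.mem_ker.1 hx, map_zero])
      hcon
    rw [hbot, finrank_bot, Nat.le_zero, Submodule.finrank_eq_zero, LinearMap.ker_eq_bot] at hcon
    exact hv.2 (hcon (by rw [hv0, map_zero]))
  have hY : LinearMap.range p' = ⊥ := by
    apply eq_bot_of_jPlus_jMinus _ (LinearMap.range q')
    · rintro _ ⟨x, rfl⟩; exact ⟨_, ha' x⟩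
    · rintro _ ⟨x, rfl⟩; exact ⟨_, hb' x⟩
    · omega
  have hQ : LinearMap.range q' = ⊥ := by
    rw [← Submodule.finrank_eq_zero (R := k)]
    rw [hY, finrank_bot] at hp1
    omega
  rw [LinearMap.range_eq_bot] at hY hQ
  exact ⟨c, sub_eq_zero.1 hY, sub_eq_zero.1 hQ⟩

end Brick

end Kronecker

/-! ### Linear algebra of representations of `Q₁` -/

section Triple

variable {k : Type u} [Field k]
variable {V₁ V₂ V₃ W₁ W₂ W₃ : Type*}
  [AddCommGroup V₁] [Module k V₁] [AddCommGroup V₂] [Module k V₂] [AddCommGroup V₃] [Module k V₃]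
  [AddCommGroup W₁] [Module k W₁] [AddCommGroup W₂] [Module k W₂] [AddCommGroup W₃] [Module k W₃]

/-- The map `(α, β, ε) ↦ (ε f - f' α, β g - g' α, ε h - h' β)` whose kernel is the space of
morphisms between the representations `(f, g, h)` and `(f', g', h')` of `Q₁`, and whose cokernel is
the space of extensions. -/
def tripleMap (f : V₁ →ₗ[k] V₃) (g : V₁ →ₗ[k] V₂) (h : V₂ →ₗ[k] V₃)
    (f' : W₁ →ₗ[k] W₃) (g' : W₁ →ₗ[k] W₂) (h' : W₂ →ₗ[k] W₃) :
    ((V₁ →ₗ[k] W₁) × (V₂ →ₗ[k] W₂) × (V₃ →ₗ[k] W₃)) →ₗ[k]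
      ((V₁ →ₗ[k] W₃) × (V₁ →ₗ[k] W₂) × (V₂ →ₗ[k] W₃)) where
  toFun x := (x.2.2 ∘ₗ f - f' ∘ₗ x.1, x.2.1 ∘ₗ g - g' ∘ₗ x.1, x.2.2 ∘ₗ h - h' ∘ₗ x.2.1)
  map_add' x y := by
    ext <;> simp <;> abel
  map_smul' c x := by
    ext <;> simp [smul_sub]

lemma mem_ker_tripleMap {f : V₁ →ₗ[k] V₃} {g : V₁ →ₗ[k] V₂} {h : V₂ →ₗ[k] V₃}
    {f' : W₁ →ₗ[k] W₃} {g' : W₁ →ₗ[k] W₂} {h' : W₂ →ₗ[k] W₃}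
    {x : (V₁ →ₗ[k] W₁) × (V₂ →ₗ[k] W₂) × (V₃ →ₗ[k] W₃)} :
    x ∈ LinearMap.ker (tripleMap f g h f' g' h') ↔
      x.2.2 ∘ₗ f = f' ∘ₗ x.1 ∧ x.2.1 ∘ₗ g = g' ∘ₗ x.1 ∧ x.2.2 ∘ₗ h = h' ∘ₗ x.2.1 := by
  simp [tripleMap, sub_eq_zero]

/-- Isomorphism of the representations `(f, g, h)` and `(f', g', h')` of `Q₁`. -/
def TripleIso (f : V₁ →ₗ[k] V₃) (g : V₁ →ₗ[k] V₂) (h : V₂ →ₗ[k] V₃)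
    (f' : W₁ →ₗ[k] W₃) (g' : W₁ →ₗ[k] W₂) (h' : W₂ →ₗ[k] W₃) : Prop :=
  ∃ (p : V₁ ≃ₗ[k] W₁) (q : V₂ ≃ₗ[k] W₂) (r : V₃ ≃ₗ[k] W₃),
    r.toLinearMap ∘ₗ f = f' ∘ₗ p.toLinearMap ∧ q.toLinearMap ∘ₗ g = g' ∘ₗ p.toLinearMap ∧
      r.toLinearMap ∘ₗ h = h' ∘ₗ q.toLinearMap

/-- The identity spans the line of endomorphisms; it is nonzero because otherwise all three spaces,
and with them the kernel, would vanish. -/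
lemma endomorphism_scalar_of_finrank_eq_one {f : V₁ →ₗ[k] V₃} {g : V₁ →ₗ[k] V₂} {h : V₂ →ₗ[k] V₃}
    (hb : Module.finrank k (LinearMap.ker (tripleMap f g h f g h)) = 1)
    (α : V₁ →ₗ[k] V₁) (β : V₂ →ₗ[k] V₂) (ε : V₃ →ₗ[k] V₃)
    (h₁ : ε ∘ₗ f = f ∘ₗ α) (h₂ : β ∘ₗ g = g ∘ₗ α) (h₃ : ε ∘ₗ h = h ∘ₗ β) :
    ∃ c : k, α = c • LinearMap.id ∧ β = c • LinearMap.id ∧ ε = c • LinearMap.id := by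
  set e : LinearMap.ker (tripleMap f g h f g h) :=
    ⟨(LinearMap.id, LinearMap.id, LinearMap.id), mem_ker_tripleMap.2 ⟨rfl, rfl, rfl⟩⟩ with he
  have he0 : e ≠ 0 := by
    intro h0
    have h0' := congrArg Subtype.val h0
    simp only [he, Submodule.coe_zero, Prod.mk_eq_zero] at h0'
    obtain ⟨x, hx, -⟩ := finrank_eq_one_iff'.1 hb
    obtain ⟨⟨x₁, x₂, x₃⟩, hx'⟩ := x
    apply hx
    ext y
    · exact (congrArg x₁ (LinearMap.congr_fun h0'.1 y)).trans (map_zero _)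
    · exact (congrArg x₂ (LinearMap.congr_fun h0'.2.1 y)).trans (map_zero _)
    · exact (congrArg x₃ (LinearMap.congr_fun h0'.2.2 y)).trans (map_zero _)
  obtain ⟨c, hc⟩ := (finrank_eq_one_iff_of_nonzero' e he0).1 hb
    ⟨(α, β, ε), mem_ker_tripleMap.2 ⟨h₁, h₂, h₃⟩⟩
  have hc' := congrArg Subtype.val hc
  simp only [he, Submodule.coe_smul, Prod.smul_mk, Prod.mk.injEq] at hc'
  exact ⟨c, hc'.1.symm, hc'.2.1.symm, hc'.2.2.symm⟩

lemma finrank_ker_eq_one_of_endomorphism_scalar {f : V₁ →ₗ[k] V₃} {g : V₁ →ₗ[k] V₂}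
    {h : V₂ →ₗ[k] V₃} (hne : Nontrivial V₁ ∨ Nontrivial V₂ ∨ Nontrivial V₃)
    (H : ∀ (α : V₁ →ₗ[k] V₁) (β : V₂ →ₗ[k] V₂) (ε : V₃ →ₗ[k] V₃),
      ε ∘ₗ f = f ∘ₗ α → β ∘ₗ g = g ∘ₗ α → ε ∘ₗ h = h ∘ₗ β →
      ∃ c : k, α = c • LinearMap.id ∧ β = c • LinearMap.id ∧ ε = c • LinearMap.id) :
    Module.finrank k (LinearMap.ker (tripleMap f g h f g h)) = 1 := by
  set e : LinearMap.ker (tripleMap f g h f g h) :=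
    ⟨(LinearMap.id, LinearMap.id, LinearMap.id), mem_ker_tripleMap.2 ⟨rfl, rfl, rfl⟩⟩ with he
  have he0 : e ≠ 0 := by
    intro h0
    have h0' := congrArg Subtype.val h0
    simp only [he, Submodule.coe_zero, Prod.mk_eq_zero] at h0'
    rcases hne with h | h | h
    · obtain ⟨x, hx⟩ := exists_ne (0 : V₁)
      exact hx (LinearMap.congr_fun h0'.1 x)
    · obtain ⟨x, hx⟩ := exists_ne (0 : V₂)
      exact hx (LinearMap.congr_fun h0'.2.1 x)
    · obtain ⟨x, hx⟩ := exists_ne (0 : V₃)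
      exact hx (LinearMap.congr_fun h0'.2.2 x)
  refine (finrank_eq_one_iff_of_nonzero' e he0).2 ?_
  rintro ⟨⟨α, β, ε⟩, hx⟩
  obtain ⟨h₁, h₂, h₃⟩ := mem_ker_tripleMap.1 hx
  obtain ⟨c, h1, h2, h3⟩ := H α β ε h₁ h₂ h₃
  refine ⟨c, Subtype.ext ?_⟩
  simp [he, h1, h2, h3]

/-- If `g v = 0` with `v ≠ 0` and `w` is outside the image, a rank-one map sending `v` to `w` cannot
be written `β g - g α`: evaluating at `v` would put `w` in the image. -/
lemma injective_or_surjective_of_rigid (g : V₁ →ₗ[k] V₂)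
    (H : ∀ γ : V₁ →ₗ[k] V₂, ∃ (α : V₁ →ₗ[k] V₁) (β : V₂ →ₗ[k] V₂), β ∘ₗ g - g ∘ₗ α = γ) :
    Function.Injective g ∨ Function.Surjective g := by
  by_contra! hcon
  obtain ⟨h1, h2⟩ := hcon
  rw [injective_iff_map_eq_zero] at h1
  push Not at h1
  obtain ⟨v, hv, hv0⟩ := h1
  obtain ⟨w, hw⟩ := not_forall.1 h2
  obtain ⟨l, hl⟩ := Module.Projective.exists_dual_eq_one k hv0
  obtain ⟨α, β, h⟩ := H (l.smulRight w)
  have := LinearMap.congr_fun h v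
  simp only [LinearMap.sub_apply, LinearMap.comp_apply, hv, map_zero, LinearMap.smulRight_apply,
    hl, one_smul, zero_sub] at this
  exact hw ⟨-α v, by rw [map_neg, this]⟩

section FiniteDimensional

variable [FiniteDimensional k V₁] [FiniteDimensional k V₂] [FiniteDimensional k V₃]

lemma tripleMap_surjective_iff {f : V₁ →ₗ[k] V₃} {g : V₁ →ₗ[k] V₂} {h : V₂ →ₗ[k] V₃}
    (hb : Module.finrank k (LinearMap.ker (tripleMap f g h f g h)) = 1) :
    Function.Surjective (tripleMap f g h f g h) ↔
      Module.finrank k V₁ * Module.finrank k V₁ + Module.finrank k V₂ * Module.finrank k V₂ +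
        Module.finrank k V₃ * Module.finrank k V₃ =
      Module.finrank k V₁ * Module.finrank k V₃ + Module.finrank k V₁ * Module.finrank k V₂ +
        Module.finrank k V₂ * Module.finrank k V₃ + 1 := by
  have h1 := (tripleMap f g h f g h).finrank_range_add_finrank_ker
  have h2 : Function.Surjective (tripleMap f g h f g h) ↔
      Module.finrank k (LinearMap.range (tripleMap f g h f g h)) =
        Module.finrank k ((V₁ →ₗ[k] V₃) × (V₁ →ₗ[k] V₂) × (V₂ →ₗ[k] V₃)) := by
    rw [← LinearMap.range_eq_top]
    exact ⟨fun h => by rw [h, finrank_top], fun h => Submodule.eq_top_of_finrank_eq h⟩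
  rw [h2]
  simp only [Module.finrank_prod, Module.finrank_linearMap] at h1 ⊢
  omega

lemma eq_dimension_vectors {x y z : ℕ} (h : x * x + y * y + z * z = x * z + x * y + y * z + 1) :
    (x = y + 1 ∧ z = y) ∨ (y = x + 1 ∧ z = x + 1) ∨ (y = x ∧ z = x + 1) ∨ (y = x ∧ x = z + 1) ∨
      (y = x + 1 ∧ z = x) ∨ (x = y + 1 ∧ z = y + 1) := by
  have h' : ((x : ℤ) - y) ^ 2 + (x - y) * (y - z) + (y - z) ^ 2 = 1 := by
    have : (x * x + y * y + z * z : ℤ) = x * z + x * y + y * z + 1 := by exact_mod_cast h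
    linarith
  -- With `u = x - y` and `v = y - z`, the equation reads `(u + 2v)² + 3u² = 4`, and symmetrically
  -- in `v`.
  have h1 : ((x : ℤ) - y) ^ 2 ≤ 1 := by nlinarith [sq_nonneg ((x : ℤ) - y + 2 * (y - z))]
  have h2 : ((y : ℤ) - z) ^ 2 ≤ 1 := by nlinarith [sq_nonneg (2 * ((x : ℤ) - y) + (y - z))]
  have h3 := abs_le.1 (sq_le_one_iff_abs_le_one _ |>.1 h1)
  have h4 := abs_le.1 (sq_le_one_iff_abs_le_one _ |>.1 h2)
  obtain ⟨u, hu⟩ : ∃ u : ℤ, u = x - y := ⟨_, rfl⟩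
  obtain ⟨v, hv⟩ : ∃ v : ℤ, v = y - z := ⟨_, rfl⟩
  rw [← hu, ← hv] at h'
  rw [← hu] at h3
  rw [← hv] at h4
  obtain ⟨h3, h3'⟩ := h3
  obtain ⟨h4, h4'⟩ := h4
  interval_cases u <;> interval_cases v <;> omega

omit [FiniteDimensional k V₃] in
/-- If the arrow `b ⟶ e` is invertible and the dimensions at `b` and `mid` differ, then the
composition of the other two arrows vanishes in both orders. -/
lemma comp_eq_zero_of_equiv (f : V₁ ≃ₗ[k] V₃) {g : V₁ →ₗ[k] V₂} {h : V₂ →ₗ[k] V₃}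
    (hb : Module.finrank k (LinearMap.ker (tripleMap f.toLinearMap g h f.toLinearMap g h)) = 1)
    (hd : Module.finrank k V₁ ≠ Module.finrank k V₂) :
    h ∘ₗ g = 0 ∧ g ∘ₗ f.symm.toLinearMap ∘ₗ h = 0 := by
  -- The loops based at the three vertices commute with the arrows. If the scalar were nonzero, both
  -- `g` and `f⁻¹ h` would be injective and the dimensions would agree.
  obtain ⟨c, h1, h2, h3⟩ := endomorphism_scalar_of_finrank_eq_one hb
    (f.symm.toLinearMap ∘ₗ h ∘ₗ g) (g ∘ₗ f.symm.toLinearMap ∘ₗ h) (h ∘ₗ g ∘ₗ f.symm.toLinearMap)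
    (by ext x; simp) (by ext x; simp) (by ext x; simp)
  have h1' : ∀ x, f.symm (h (g x)) = c • x := fun x => LinearMap.congr_fun h1 x
  have h2' : ∀ x, g (f.symm (h x)) = c • x := fun x => LinearMap.congr_fun h2 x
  by_cases hc : c = 0
  · subst hc
    refine ⟨?_, by rw [h2, zero_smul]⟩
    ext x
    have := h1' x
    rw [zero_smul, LinearEquiv.map_eq_zero_iff] at this
    exact this
  · refine absurd (le_antisymm ?_ ?_) hd
    · apply LinearMap.finrank_le_finrank_of_injective (f := g)
      rw [injective_iff_map_eq_zero]
      intro x hx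
      have := h1' x
      rw [hx, map_zero, map_zero] at this
      exact (smul_eq_zero.1 this.symm).resolve_left hc
    · apply LinearMap.finrank_le_finrank_of_injective (f := f.symm.toLinearMap ∘ₗ h)
      rw [injective_iff_map_eq_zero]
      intro x hx
      have := h2' x
      have hx' : f.symm (h x) = 0 := hx
      rw [hx', map_zero] at this
      exact (smul_eq_zero.1 this.symm).resolve_left hc

variable {f : V₁ →ₗ[k] V₃} {g : V₁ →ₗ[k] V₂} {h : V₂ →ₗ[k] V₃}

omit [FiniteDimensional k V₁] [FiniteDimensional k V₂] [FiniteDimensional k V₃] in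
lemma max_rank_of_rigid (hs : Function.Surjective (tripleMap f g h f g h)) :
    (Function.Injective f ∨ Function.Surjective f) ∧
    (Function.Injective g ∨ Function.Surjective g) ∧
    (Function.Injective h ∨ Function.Surjective h) := by
  refine ⟨injective_or_surjective_of_rigid f fun γ => ?_,
    injective_or_surjective_of_rigid g fun γ => ?_,
    injective_or_surjective_of_rigid h fun γ => ?_⟩
  · obtain ⟨x, hx⟩ := hs (γ, 0, 0)
    exact ⟨x.1, x.2.2, congrArg (fun y => y.1) hx⟩
  · obtain ⟨x, hx⟩ := hs (0, γ, 0)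
    exact ⟨x.1, x.2.1, congrArg (fun y => y.2.1) hx⟩
  · obtain ⟨x, hx⟩ := hs (0, 0, γ)
    exact ⟨x.2.1, x.2.2, congrArg (fun y => y.2.2) hx⟩

-- Contracting an invertible `h` preserves rigidity: prescribing a zero third component forces `β =
-- h⁻¹ ε h`, which eliminates `β`.
omit [FiniteDimensional k V₁] [FiniteDimensional k V₂] [FiniteDimensional k V₃] in
lemma pencilMap_surjective_of_right {h : V₂ ≃ₗ[k] V₃}
    (hs : Function.Surjective (tripleMap f g h.toLinearMap f g h.toLinearMap)) :
    Function.Surjective (pencilMap f (h.toLinearMap ∘ₗ g) f (h.toLinearMap ∘ₗ g)) := by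
  rintro ⟨φ, ψ⟩
  obtain ⟨⟨α, β, ε⟩, hx⟩ := hs (φ, h.symm.toLinearMap ∘ₗ ψ, 0)
  simp only [tripleMap, LinearMap.coe_mk, AddHom.coe_mk, Prod.mk.injEq, sub_eq_zero] at hx
  refine ⟨(α, ε), ?_⟩
  simp only [pencilMap, LinearMap.coe_mk, AddHom.coe_mk, Prod.mk.injEq]
  refine ⟨hx.1, ?_⟩
  ext x
  have h1 := congrArg h (LinearMap.congr_fun hx.2.1 x)
  have h2 := LinearMap.congr_fun hx.2.2 (g x)
  simp at h1 h2
  simp [← h1, h2]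

omit [FiniteDimensional k V₁] [FiniteDimensional k V₂] [FiniteDimensional k V₃] in
lemma pencilMap_surjective_of_left {g : V₁ ≃ₗ[k] V₂}
    (hs : Function.Surjective (tripleMap f g.toLinearMap h f g.toLinearMap h)) :
    Function.Surjective (pencilMap f (h ∘ₗ g.toLinearMap) f (h ∘ₗ g.toLinearMap)) := by
  rintro ⟨φ, ψ⟩
  obtain ⟨⟨α, β, ε⟩, hx⟩ := hs (φ, 0, ψ ∘ₗ g.symm.toLinearMap)
  simp only [tripleMap, LinearMap.coe_mk, AddHom.coe_mk, Prod.mk.injEq, sub_eq_zero] at hx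
  refine ⟨(α, ε), ?_⟩
  simp only [pencilMap, LinearMap.coe_mk, AddHom.coe_mk, Prod.mk.injEq]
  refine ⟨hx.1, ?_⟩
  ext x
  have h1 := LinearMap.congr_fun hx.2.1 x
  have h2 := LinearMap.congr_fun hx.2.2 (g x)
  simp at h1 h2
  simp [← h1, h2]

omit [FiniteDimensional k V₁] [FiniteDimensional k V₂] [FiniteDimensional k V₃] in
lemma tripleIso_of_right {a b : W₁ →ₗ[k] W₃} (h : V₂ ≃ₗ[k] V₃) (p : V₁ ≃ₗ[k] W₁) (q : V₃ ≃ₗ[k] W₃)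
    (ha : q.toLinearMap ∘ₗ f = a ∘ₗ p.toLinearMap)
    (hb : q.toLinearMap ∘ₗ h.toLinearMap ∘ₗ g = b ∘ₗ p.toLinearMap) :
    TripleIso f g h.toLinearMap a b LinearMap.id :=
  ⟨p, h.trans q, q, ha, hb, rfl⟩

omit [FiniteDimensional k V₁] [FiniteDimensional k V₂] [FiniteDimensional k V₃] in
lemma tripleIso_of_left {a b : W₁ →ₗ[k] W₃} (g : V₁ ≃ₗ[k] V₂) (p : V₁ ≃ₗ[k] W₁) (q : V₃ ≃ₗ[k] W₃)
    (ha : q.toLinearMap ∘ₗ f = a ∘ₗ p.toLinearMap)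
    (hb : q.toLinearMap ∘ₗ h ∘ₗ g.toLinearMap = b ∘ₗ p.toLinearMap) :
    TripleIso f g.toLinearMap h a LinearMap.id b :=
  ⟨p, g.symm.trans p, q, ha, by ext x; simp, by
    ext x
    obtain ⟨y, rfl⟩ := g.surjective x
    simpa using LinearMap.congr_fun hb y⟩

omit [FiniteDimensional k V₁] [FiniteDimensional k V₂] in
lemma exists_equiv_of_max_rank {g : V₁ →ₗ[k] V₂} (hg : Function.Injective g ∨ Function.Surjective g)
    [FiniteDimensional k V₁] [FiniteDimensional k V₂]
    (hd : Module.finrank k V₁ = Module.finrank k V₂) :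
    ∃ e : V₁ ≃ₗ[k] V₂, e.toLinearMap = g := by
  have := LinearMap.injective_iff_surjective_of_finrank_eq_finrank (f := g) hd
  have hbij : Function.Bijective g := by
    rcases hg with h | h
    · exact ⟨h, this.1 h⟩
    · exact ⟨this.2 h, h⟩
  exact ⟨LinearEquiv.ofBijective g hbij, rfl⟩

theorem tripleIso_of_rigid_brick
    (hb : Module.finrank k (LinearMap.ker (tripleMap f g h f g h)) = 1)
    (hs : Function.Surjective (tripleMap f g h f g h)) :
    (∃ m, TripleIso f g h (piPlus k m) (piMinus k m) LinearMap.id) ∨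
    (∃ m, TripleIso f g h (jPlus k m) (jMinus k m) LinearMap.id) ∨
    (∃ m, TripleIso f g h (jPlus k m) LinearMap.id (jMinus k m)) ∨
    (∃ m, TripleIso f g h (piPlus k m) LinearMap.id (piMinus k m)) ∨
    TripleIso f g h (0 : PUnit.{u + 1} →ₗ[k] PUnit.{u + 1}) (0 : _ →ₗ[k] k) 0 ∨
    TripleIso f g h (LinearMap.id : k →ₗ[k] k) (0 : _ →ₗ[k] PUnit.{u + 1}) 0 := by
  obtain ⟨hf, hg, hh⟩ := max_rank_of_rigid hs
  rcases eq_dimension_vectors ((tripleMap_surjective_iff hb).1 hs) with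
    ⟨h1, h2⟩ | ⟨h1, h2⟩ | ⟨h1, h2⟩ | ⟨h1, h2⟩ | ⟨h1, h2⟩ | ⟨h1, h2⟩
  · obtain ⟨e, rfl⟩ := exists_equiv_of_max_rank hh h2.symm
    obtain ⟨p, q, ha, hb⟩ := exists_equiv_pi_of_rigid _ _ (pencilMap_surjective_of_right hs) h1 h2
    exact .inl ⟨_, tripleIso_of_right e p q ha hb⟩
  · obtain ⟨e, rfl⟩ := exists_equiv_of_max_rank hh (h1.trans h2.symm)
    obtain ⟨p, q, ha, hb⟩ := exists_equiv_j_of_rigid _ _ (pencilMap_surjective_of_right hs) rfl h2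
    refine .inr (.inl ⟨_, tripleIso_of_right e p.symm q.symm ?_ ?_⟩)
    · rw [LinearEquiv.toLinearMap_symm_comp_eq, ← LinearMap.comp_assoc, ha]
      ext x; simp
    · rw [LinearEquiv.toLinearMap_symm_comp_eq, ← LinearMap.comp_assoc, hb]
      ext x; simp
  · obtain ⟨e, rfl⟩ := exists_equiv_of_max_rank hg h1.symm
    obtain ⟨p, q, ha, hb⟩ := exists_equiv_j_of_rigid _ _ (pencilMap_surjective_of_left hs) rfl h2
    refine .inr (.inr (.inl ⟨_, tripleIso_of_left e p.symm q.symm ?_ ?_⟩))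
    · rw [LinearEquiv.toLinearMap_symm_comp_eq, ← LinearMap.comp_assoc, ha]
      ext x; simp
    · rw [LinearEquiv.toLinearMap_symm_comp_eq, ← LinearMap.comp_assoc, hb]
      ext x; simp
  · obtain ⟨e, rfl⟩ := exists_equiv_of_max_rank hg h1.symm
    obtain ⟨p, q, ha, hb⟩ := exists_equiv_pi_of_rigid _ _ (pencilMap_surjective_of_left hs) h2 rfl
    exact .inr (.inr (.inr (.inl ⟨_, tripleIso_of_left e p q ha hb⟩)))
  -- Here `g` is injective and `h` surjective, so `g f⁻¹ h = 0` forces the spaces at `b` and `e` to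
  -- vanish.
  · obtain ⟨e, rfl⟩ := exists_equiv_of_max_rank hf h2.symm
    obtain ⟨h3, h4⟩ := comp_eq_zero_of_equiv e hb (by omega)
    have hgi : Function.Injective g := by
      rcases hg with hg | hg
      · exact hg
      · have := LinearMap.finrank_le_finrank_of_surjective hg
        omega
    have hhs : Function.Surjective h := by
      rcases hh with hh | hh
      · have := LinearMap.finrank_le_finrank_of_injective hh
        omega
      · exact hh
    have hV₃ : Subsingleton V₃ := by
      refine subsingleton_of_forall_eq 0 fun y => ?_
      obtain ⟨x, rfl⟩ := hhs y
      have h5 : g (e.symm (h x)) = 0 := LinearMap.congr_fun h4 x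
      rw [map_eq_zero_iff g hgi, LinearEquiv.map_eq_zero_iff] at h5
      exact h5
    have hV₁ : Subsingleton V₁ := e.injective.subsingleton
    have hd : Module.finrank k V₁ = 0 := Module.finrank_zero_of_subsingleton
    refine .inr (.inr (.inr (.inr (.inl ⟨LinearEquiv.ofSubsingleton _ _,
      LinearEquiv.ofFinrankEq _ _ (by rw [Module.finrank_self, h1, hd]),
      LinearEquiv.ofSubsingleton _ _, ?_, ?_, ?_⟩))))
    · exact Subsingleton.elim _ _
    · exact LinearMap.ext fun x => by simp [Subsingleton.elim x 0]
    · exact Subsingleton.elim _ _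
  -- Here `g` is surjective and `h` injective, so `h g = 0` forces the space at `mid` to vanish.
  · obtain ⟨e, rfl⟩ := exists_equiv_of_max_rank hf (h1.trans h2.symm)
    obtain ⟨h3, h4⟩ := comp_eq_zero_of_equiv e hb (by omega)
    have hgs : Function.Surjective g := by
      rcases hg with hg | hg
      · have := LinearMap.finrank_le_finrank_of_injective hg
        omega
      · exact hg
    have hhi : Function.Injective h := by
      rcases hh with hh | hh
      · exact hh
      · have := LinearMap.finrank_le_finrank_of_surjective hh
        omega
    have hV₂ : Subsingleton V₂ := by
      refine subsingleton_of_forall_eq 0 fun y => ?_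
      obtain ⟨x, rfl⟩ := hgs y
      have h5 : h (g x) = 0 := LinearMap.congr_fun h3 x
      rwa [map_eq_zero_iff h hhi] at h5
    have hd : Module.finrank k V₂ = 0 := Module.finrank_zero_of_subsingleton
    have p : V₁ ≃ₗ[k] k := LinearEquiv.ofFinrankEq _ _ (by rw [Module.finrank_self, h1, hd])
    refine .inr (.inr (.inr (.inr (.inr ⟨p, LinearEquiv.ofSubsingleton _ _,
      e.symm.trans p, ?_, ?_, ?_⟩))))
    · ext x; simp
    · exact Subsingleton.elim _ _
    · exact LinearMap.ext fun x => by simp [Subsingleton.elim x 0]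

end FiniteDimensional

end Triple

/-! ### Representations of `Q₁` as triples of linear maps -/

/-- A natural transformation of functors on a path category from its components at the vertices. -/
def pathsNatTrans {Q C : Type*} [Quiver Q] [Category C] (F G : Paths Q ⥤ C)
    (α : ∀ x : Q, F.obj ((Paths.of Q).obj x) ⟶ G.obj ((Paths.of Q).obj x))
    (h : ∀ {x y : Q} (a : x ⟶ y),
      F.map ((Paths.of Q).map a) ≫ α y = α x ≫ G.map ((Paths.of Q).map a)) : F ⟶ G where
  app := α
  naturality x y p := by
    let α' : ∀ x : Paths Q, F.obj x ⟶ G.obj x := α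
    change F.map p ≫ α' y = α' x ≫ G.map p
    refine Paths.induction (fun {x y} p => F.map p ≫ α' y = α' x ≫ G.map p) ?_ ?_ p
    · intro v
      simp
    · intro x y z p q ih
      have hq : F.map ((Paths.of Q).map q) ≫ α' ((Paths.of Q).obj z) =
        α' ((Paths.of Q).obj y) ≫ G.map ((Paths.of Q).map q) := h q
      rw [F.map_comp, G.map_comp, Category.assoc, hq, ← Category.assoc, ih, Category.assoc]

namespace QOne

variable {k : Type u} [Field k]

/-- The space of a representation at a vertex. -/
abbrev spaceAt (X : QuiverRep k QOne) (x : QOne) : FGModuleCat.{u} k :=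
  X.obj ((Paths.of QOne).obj x)

/-- The linear map of a representation at an arrow. -/
def mapAt (X : QuiverRep k QOne) {x y : QOne} (a : x ⟶ y) : spaceAt X x →ₗ[k] spaceAt X y :=
  (X.map ((Paths.of QOne).map a)).hom.hom

/-- The linear map of a morphism of representations at a vertex. -/
def appAt {X Y : QuiverRep k QOne} (φ : X ⟶ Y) (x : QOne) : spaceAt X x →ₗ[k] spaceAt Y x :=
  (φ.app ((Paths.of QOne).obj x)).hom.hom

/-- The map `V_b → V_e` of a representation. -/
def mapBE (X : QuiverRep k QOne) : spaceAt X b →ₗ[k] spaceAt X e := mapAt X Arrow.be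

/-- The map `V_b → V_mid` of a representation. -/
def mapBM (X : QuiverRep k QOne) : spaceAt X b →ₗ[k] spaceAt X mid := mapAt X Arrow.bmid

/-- The map `V_mid → V_e` of a representation. -/
def mapME (X : QuiverRep k QOne) : spaceAt X mid →ₗ[k] spaceAt X e := mapAt X Arrow.mide

section Hom

variable {X Y Z : QuiverRep k QOne}

@[simp] lemma appAt_comp (φ : X ⟶ Y) (ψ : Y ⟶ Z) (x : QOne) :
    appAt (φ ≫ ψ) x = appAt ψ x ∘ₗ appAt φ x := rfl

@[simp] lemma appAt_id (x : QOne) : appAt (𝟙 X) x = LinearMap.id := rfl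

lemma mapAt_naturality (φ : X ⟶ Y) {x y : QOne} (a : x ⟶ y) :
    appAt φ y ∘ₗ mapAt X a = mapAt Y a ∘ₗ appAt φ x :=
  congrArg (fun ψ => ψ.hom.hom) (φ.naturality ((Paths.of QOne).map a))

lemma hom_ext_of_appAt {φ ψ : X ⟶ Y} (hb : appAt φ b = appAt ψ b) (hm : appAt φ mid = appAt ψ mid)
    (he : appAt φ e = appAt ψ e) : φ = ψ := by
  apply NatTrans.ext
  funext x
  apply FGModuleCat.hom_ext
  cases x
  · exact hb
  · exact hm
  · exact he

/-- A family of linear maps commuting with the arrows, as a morphism of representations. -/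
def homOfAppAt (α : ∀ x : QOne, spaceAt X x →ₗ[k] spaceAt Y x)
    (h : ∀ {x y : QOne} (a : x ⟶ y), α y ∘ₗ mapAt X a = mapAt Y a ∘ₗ α x) : X ⟶ Y :=
  pathsNatTrans X Y (fun x => FGModuleCat.ofHom (α x)) (fun a => FGModuleCat.hom_ext (h a))

/-- A morphism of representations from its three components. -/
def homMk (α : spaceAt X b →ₗ[k] spaceAt Y b) (β : spaceAt X mid →ₗ[k] spaceAt Y mid)
    (ε : spaceAt X e →ₗ[k] spaceAt Y e) (h₁ : ε ∘ₗ mapBE X = mapBE Y ∘ₗ α)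
    (h₂ : β ∘ₗ mapBM X = mapBM Y ∘ₗ α) (h₃ : ε ∘ₗ mapME X = mapME Y ∘ₗ β) : X ⟶ Y :=
  homOfAppAt (fun x => match x with
    | .b => α
    | .mid => β
    | .e => ε) (fun a => match a with
    | .be => h₁
    | .bmid => h₂
    | .mide => h₃)

/-- Morphisms of representations as the kernel of `tripleMap`. -/
def homLinearEquiv (X Y : QuiverRep k QOne) :
    (X ⟶ Y) ≃ₗ[k] LinearMap.ker
      (tripleMap (mapBE X) (mapBM X) (mapME X) (mapBE Y) (mapBM Y) (mapME Y)) where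
  toFun φ := ⟨(appAt φ b, appAt φ mid, appAt φ e), mem_ker_tripleMap.2
    ⟨mapAt_naturality φ _, mapAt_naturality φ _, mapAt_naturality φ _⟩⟩
  map_add' _ _ := rfl
  map_smul' _ _ := rfl
  invFun x := homMk x.1.1 x.1.2.1 x.1.2.2 (mem_ker_tripleMap.1 x.2).1
    (mem_ker_tripleMap.1 x.2).2.1 (mem_ker_tripleMap.1 x.2).2.2
  left_inv _ := hom_ext_of_appAt rfl rfl rfl
  right_inv _ := rfl

lemma nonempty_iso_iff : Nonempty (X ≅ Y) ↔
    TripleIso (mapBE X) (mapBM X) (mapME X) (mapBE Y) (mapBM Y) (mapME Y) := by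
  constructor
  · rintro ⟨i⟩
    let E : ∀ x : QOne, spaceAt X x ≃ₗ[k] spaceAt Y x := fun x =>
      LinearEquiv.ofLinearMap (appAt i.hom x) (appAt i.inv x)
        (by rw [← appAt_comp, i.inv_hom_id, appAt_id])
        (by rw [← appAt_comp, i.hom_inv_id, appAt_id])
    exact ⟨E b, E mid, E e, mapAt_naturality i.hom _, mapAt_naturality i.hom _,
      mapAt_naturality i.hom _⟩
  · rintro ⟨p, q, r, h₁, h₂, h₃⟩
    refine ⟨homMk p.toLinearMap q.toLinearMap r.toLinearMap h₁ h₂ h₃,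
      homMk p.symm.toLinearMap q.symm.toLinearMap r.symm.toLinearMap ?_ ?_ ?_,
      hom_ext_of_appAt ?_ ?_ ?_, hom_ext_of_appAt ?_ ?_ ?_⟩
    · rw [LinearEquiv.toLinearMap_symm_comp_eq, ← LinearMap.comp_assoc, h₁]
      ext x; simp
    · rw [LinearEquiv.toLinearMap_symm_comp_eq, ← LinearMap.comp_assoc, h₂]
      ext x; simp
    · rw [LinearEquiv.toLinearMap_symm_comp_eq, ← LinearMap.comp_assoc, h₃]
      ext x; simp
    · exact LinearMap.ext p.symm_apply_apply
    · exact LinearMap.ext q.symm_apply_apply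
    · exact LinearMap.ext r.symm_apply_apply
    · exact LinearMap.ext p.apply_symm_apply
    · exact LinearMap.ext q.apply_symm_apply
    · exact LinearMap.ext r.apply_symm_apply

end Hom

section MkRep

variable {Vb Vmid Ve : Type u}
    [AddCommGroup Vb] [Module k Vb] [Module.Finite k Vb]
    [AddCommGroup Vmid] [Module k Vmid] [Module.Finite k Vmid]
    [AddCommGroup Ve] [Module k Ve] [Module.Finite k Ve]
    (f : Vb →ₗ[k] Ve) (g : Vb →ₗ[k] Vmid) (h : Vmid →ₗ[k] Ve)

lemma mapBE_mkRep : mapBE (mkRep k f g h) = f := rfl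

lemma mapBM_mkRep : mapBM (mkRep k f g h) = g := rfl

lemma mapME_mkRep : mapME (mkRep k f g h) = h := rfl

lemma nonempty_iso_mkRep_iff {X : QuiverRep k QOne} : Nonempty (X ≅ mkRep k f g h) ↔
    TripleIso (mapBE X) (mapBM X) (mapME X) f g h := by
  rw [nonempty_iso_iff, mapBE_mkRep, mapBM_mkRep, mapME_mkRep]
  rfl

end MkRep

end QOne

/-! ### Ext groups from a two-term projective resolution -/

section ProjectiveResolution

open Abelian

variable {C : Type v} [Category.{w} C] [Abelian C] [HasExt.{u} C] {S : ShortComplex C}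

/-- In the long exact sequence `Ext¹(X₂, Y) = 0`, so `Ext¹(X₃, Y)` is the cokernel of restriction
from `Hom(X₂, Y)` to `Hom(X₁, Y)`. -/
lemma subsingleton_ext_one_iff (hS : S.ShortExact) [Projective S.X₂] (Y : C) :
    Subsingleton (Ext.{u} S.X₃ Y 1) ↔ ∀ φ : S.X₁ ⟶ Y, ∃ ψ : S.X₂ ⟶ Y, S.f ≫ ψ = φ := by
  constructor
  · intro _ φ
    obtain ⟨x, hx⟩ := Ext.contravariant_sequence_exact₁ hS Y (Ext.mk₀ φ) (n₁ := 1) rfl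
      (Subsingleton.elim _ _)
    obtain ⟨ψ, rfl⟩ := (Ext.mk₀_bijective _ _).2 x
    rw [Ext.mk₀_comp_mk₀] at hx
    exact ⟨ψ, (Ext.mk₀_bijective _ _).1 hx⟩
  · intro H
    refine subsingleton_of_forall_eq 0 fun x => ?_
    obtain ⟨y, rfl⟩ := Ext.contravariant_sequence_exact₃ hS Y x (Ext.eq_zero_of_projective _)
      (n₀ := 0) rfl
    obtain ⟨φ, rfl⟩ := (Ext.mk₀_bijective _ _).2 y
    obtain ⟨ψ, rfl⟩ := H φ
    rw [← Ext.mk₀_comp_mk₀, hS.extClass_comp_assoc]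

lemma subsingleton_ext_add_two (hS : S.ShortExact) [Projective S.X₁] [Projective S.X₂] (Y : C)
    (n : ℕ) : Subsingleton (Ext.{u} S.X₃ Y (n + 2)) := by
  refine subsingleton_of_forall_eq 0 fun x => ?_
  obtain ⟨y, rfl⟩ := Ext.contravariant_sequence_exact₃ hS Y x (Ext.eq_zero_of_projective _)
    (n₀ := n + 1) (by omega)
  rw [Ext.eq_zero_of_projective y, Ext.comp_zero]

end ProjectiveResolution

namespace QOne

variable {k : Type u} [Field k]

/-! ### Exactness checked vertex by vertex -/

section Exact

variable {X Y Z : QuiverRep k QOne}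

lemma appAt_surjective_of_epi (φ : X ⟶ Y) [Epi φ] (x : QOne) : Function.Surjective (appAt φ x) := by
  have h : Epi (φ.app ((Paths.of QOne).obj x)) := (NatTrans.epi_iff_epi_app φ).1 inferInstance _
  have h' : Epi ((forget₂ (FGModuleCat k) (ModuleCat k)).map (φ.app ((Paths.of QOne).obj x))) :=
    inferInstance
  exact (ModuleCat.epi_iff_surjective _).1 h'

/-- The factorizations at the vertices are compatible with the arrows because `ι` can be cancelled.
-/
lemma exists_lift_of_injective (ι : X ⟶ Y) (hι : ∀ x, Function.Injective (appAt ι x)) (t : Z ⟶ Y)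
    (ht : ∀ x, LinearMap.range (appAt t x) ≤ LinearMap.range (appAt ι x)) :
    ∃ s : Z ⟶ X, s ≫ ι = t := by
  have hs : ∀ x, ∃ s : spaceAt Z x →ₗ[k] spaceAt X x, appAt ι x ∘ₗ s = appAt t x := by
    intro x
    refine ⟨(LinearEquiv.ofInjective (appAt ι x) (hι x)).symm.toLinearMap ∘ₗ
      (appAt t x).codRestrict _ (fun z => ht x ⟨z, rfl⟩), ?_⟩
    ext z
    exact congrArg Subtype.val
      ((LinearEquiv.ofInjective (appAt ι x) (hι x)).apply_symm_apply ⟨appAt t x z, ht x ⟨z, rfl⟩⟩)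
  choose s hs using hs
  refine ⟨homOfAppAt s fun {x y} a => ?_, hom_ext_of_appAt (hs b) (hs mid) (hs e)⟩
  apply LinearMap.cancel_left (hι y) |>.1
  rw [← LinearMap.comp_assoc, hs, mapAt_naturality, ← LinearMap.comp_assoc, mapAt_naturality ι,
    LinearMap.comp_assoc, hs]

lemma shortExact_of_appAt (ι : X ⟶ Y) (π : Y ⟶ Z) (w : ι ≫ π = 0)
    (hι : ∀ x, Function.Injective (appAt ι x)) (hπ : ∀ x, Function.Surjective (appAt π x))
    (hw : ∀ x, LinearMap.ker (appAt π x) ≤ LinearMap.range (appAt ι x)) :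
    (ShortComplex.mk ι π w).ShortExact := by
  have hmono : Mono ι := ⟨fun s t hst => hom_ext_of_appAt
    ((LinearMap.cancel_left (hι b)).1 (congrArg (fun φ => appAt φ b) hst))
    ((LinearMap.cancel_left (hι mid)).1 (congrArg (fun φ => appAt φ mid) hst))
    ((LinearMap.cancel_left (hι e)).1 (congrArg (fun φ => appAt φ e) hst))⟩
  have hepi : Epi π := ⟨fun s t hst => hom_ext_of_appAt
    ((LinearMap.cancel_right (hπ b)).1 (congrArg (fun φ => appAt φ b) hst))
    ((LinearMap.cancel_right (hπ mid)).1 (congrArg (fun φ => appAt φ mid) hst))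
    ((LinearMap.cancel_right (hπ e)).1 (congrArg (fun φ => appAt φ e) hst))⟩
  have hlift : ∀ {T : QuiverRep k QOne} (t : T ⟶ Y), t ≫ π = 0 → ∃ s : T ⟶ X, s ≫ ι = t := by
    intro T t ht
    refine exists_lift_of_injective ι hι t fun x => le_trans ?_ (hw x)
    rintro _ ⟨z, rfl⟩
    exact LinearMap.congr_fun (congrArg (fun φ => appAt φ x) ht) z
  have hexact : (ShortComplex.mk ι π w).Exact := ShortComplex.exact_of_f_is_kernel _
    (Limits.KernelFork.IsLimit.ofι' _ _ fun t ht => ⟨(hlift t ht).choose, (hlift t ht).choose_spec⟩)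
  exact { exact := hexact }

end Exact

/-! ### Free representations and their projectivity -/

section Free

variable (A B C : Type u) [AddCommGroup A] [Module k A] [Module.Finite k A]
  [AddCommGroup B] [Module k B] [Module.Finite k B]
  [AddCommGroup C] [Module k C] [Module.Finite k C]

/-- The map `A × B → A × A × B × C` of the free representation. -/
def freeMapME : A × B →ₗ[k] A × A × B × C :=
  LinearMap.inr k A (A × B × C) ∘ₗ LinearMap.prodMap LinearMap.id (LinearMap.inl k B C)

variable (k) in
/-- The representation freely generated by `A`, `B`, `C` at the vertices `b`, `mid`, `e`. Its space
at `e` is the sum of the copies of `A` along `b ⟶ e` and `b ⟶ mid ⟶ e`, of `B`, and of `C`. -/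
def free : QuiverRep k QOne :=
  mkRep k (Vb := A) (Vmid := A × B) (Ve := A × A × B × C)
    (LinearMap.inl k A (A × B × C)) (LinearMap.inl k A B) (freeMapME A B C)

variable {A B C} {Y Z : QuiverRep k QOne}

omit [Module.Finite k A] [Module.Finite k B] [Module.Finite k C] in
lemma freeDesc_comp_freeMapME (α : A →ₗ[k] spaceAt Y b) (β : B →ₗ[k] spaceAt Y mid)
    (ε : C →ₗ[k] spaceAt Y e) :
    (LinearMap.coprod (mapBE Y ∘ₗ α) (LinearMap.coprod (mapME Y ∘ₗ mapBM Y ∘ₗ α)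
      (LinearMap.coprod (mapME Y ∘ₗ β) ε))) ∘ₗ freeMapME A B C =
    mapME Y ∘ₗ LinearMap.coprod (mapBM Y ∘ₗ α) β :=
  LinearMap.ext fun x => by simp [freeMapME]

/-- The morphism out of a free representation with given values on the generators. -/
def freeDesc (α : A →ₗ[k] spaceAt Y b) (β : B →ₗ[k] spaceAt Y mid) (ε : C →ₗ[k] spaceAt Y e) :
    free k A B C ⟶ Y :=
  homMk (X := free k A B C) α (LinearMap.coprod (mapBM Y ∘ₗ α) β)
    (LinearMap.coprod (mapBE Y ∘ₗ α) (LinearMap.coprod (mapME Y ∘ₗ mapBM Y ∘ₗ α)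
      (LinearMap.coprod (mapME Y ∘ₗ β) ε)))
    (LinearMap.coprod_inl _ _) (LinearMap.coprod_inl _ _) (freeDesc_comp_freeMapME α β ε)

lemma appAt_freeDesc_mid (α : A →ₗ[k] spaceAt Y b) (β : B →ₗ[k] spaceAt Y mid)
    (ε : C →ₗ[k] spaceAt Y e) (x : A × B) :
    appAt (freeDesc α β ε) mid x = mapBM Y (α x.1) + β x.2 := rfl

lemma appAt_freeDesc_e (α : A →ₗ[k] spaceAt Y b) (β : B →ₗ[k] spaceAt Y mid)
    (ε : C →ₗ[k] spaceAt Y e) (x : A × A × B × C) :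
    appAt (freeDesc α β ε) e x = mapBE Y (α x.1) + (mapME Y (mapBM Y (α x.2.1)) +
      (mapME Y (β x.2.2.1) + ε x.2.2.2)) := rfl

lemma exists_eq_freeDesc (φ : free k A B C ⟶ Y) :
    ∃ (α : A →ₗ[k] spaceAt Y b) (β : B →ₗ[k] spaceAt Y mid) (ε : C →ₗ[k] spaceAt Y e),
      φ = freeDesc α β ε := by
  have h₁ : ∀ x : A, appAt φ e ((x, 0, 0, 0) : A × A × B × C) = mapBE Y (appAt φ b x) :=
    LinearMap.congr_fun (mapAt_naturality φ Arrow.be)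
  have h₂ : ∀ x : A, appAt φ mid ((x, 0) : A × B) = mapBM Y (appAt φ b x) :=
    LinearMap.congr_fun (mapAt_naturality φ Arrow.bmid)
  have h₃ : ∀ x : A × B, appAt φ e ((0, x.1, x.2, 0) : A × A × B × C) = mapME Y (appAt φ mid x) :=
    LinearMap.congr_fun (mapAt_naturality φ Arrow.mide)
  let φm : A × B →ₗ[k] spaceAt Y mid := appAt φ mid
  let φe : A × A × B × C →ₗ[k] spaceAt Y e := appAt φ e
  refine ⟨appAt φ b, φm ∘ₗ LinearMap.inr k A B, φe ∘ₗ LinearMap.inr k A (A × B × C) ∘ₗ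
    LinearMap.inr k A (B × C) ∘ₗ LinearMap.inr k B C, hom_ext_of_appAt rfl ?_ ?_⟩
  · refine LinearMap.ext fun (x : A × B) => ?_
    change φm x = mapBM Y (appAt φ b x.1) + φm (0, x.2)
    rw [show mapBM Y (appAt φ b x.1) = φm (x.1, 0) from (h₂ x.1).symm, ← map_add]
    simp
  · refine LinearMap.ext fun (x : A × A × B × C) => ?_
    change φe x = mapBE Y (appAt φ b x.1) + (mapME Y (mapBM Y (appAt φ b x.2.1)) +
      (mapME Y (φm (0, x.2.2.1)) + φe (0, 0, 0, x.2.2.2)))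
    rw [show mapBE Y (appAt φ b x.1) = φe (x.1, 0, 0, 0) from (h₁ x.1).symm,
      show mapBM Y (appAt φ b x.2.1) = φm (x.2.1, 0) from (h₂ x.2.1).symm,
      show mapME Y (φm (x.2.1, 0)) = φe (0, x.2.1, 0, 0) from (h₃ (x.2.1, 0)).symm,
      show mapME Y (φm (0, x.2.2.1)) = φe (0, 0, x.2.2.1, 0) from (h₃ (0, x.2.2.1)).symm]
    rw [← map_add, ← map_add, ← map_add]
    exact congrArg φe (Prod.ext (by simp) (Prod.ext (by simp) (Prod.ext (by simp) (by simp))))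

lemma freeDesc_comp (α : A →ₗ[k] spaceAt Y b) (β : B →ₗ[k] spaceAt Y mid) (ε : C →ₗ[k] spaceAt Y e)
    (φ : Y ⟶ Z) : freeDesc α β ε ≫ φ =
      freeDesc (appAt φ b ∘ₗ α) (appAt φ mid ∘ₗ β) (appAt φ e ∘ₗ ε) := by
  have h₁ : ∀ x, appAt φ e (mapBE Y x) = mapBE Z (appAt φ b x) :=
    LinearMap.congr_fun (mapAt_naturality φ Arrow.be)
  have h₂ : ∀ x, appAt φ mid (mapBM Y x) = mapBM Z (appAt φ b x) :=
    LinearMap.congr_fun (mapAt_naturality φ Arrow.bmid)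
  have h₃ : ∀ x, appAt φ e (mapME Y x) = mapME Z (appAt φ mid x) :=
    LinearMap.congr_fun (mapAt_naturality φ Arrow.mide)
  refine hom_ext_of_appAt rfl (LinearMap.ext fun (x : A × B) => ?_)
    (LinearMap.ext fun (x : A × A × B × C) => ?_)
  · change appAt φ mid (mapBM Y (α x.1) + β x.2) = mapBM Z (appAt φ b (α x.1)) + appAt φ mid (β x.2)
    rw [map_add, h₂]
  · change appAt φ e (mapBE Y (α x.1) + (mapME Y (mapBM Y (α x.2.1)) +
      (mapME Y (β x.2.2.1) + ε x.2.2.2))) = mapBE Z (appAt φ b (α x.1)) +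
      (mapME Z (mapBM Z (appAt φ b (α x.2.1))) + (mapME Z (appAt φ mid (β x.2.2.1)) +
        appAt φ e (ε x.2.2.2)))
    rw [map_add, map_add, map_add, h₁, h₃, h₃, h₂]

lemma freeDesc_inj {α α' : A →ₗ[k] spaceAt Y b} {β β' : B →ₗ[k] spaceAt Y mid}
    {ε ε' : C →ₗ[k] spaceAt Y e} :
    freeDesc α β ε = freeDesc α' β' ε' ↔ α = α' ∧ β = β' ∧ ε = ε' := by
  constructor
  · intro h
    refine ⟨congrArg (fun φ => appAt φ b) h, LinearMap.ext fun x => ?_, LinearMap.ext fun x => ?_⟩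
    · have := LinearMap.congr_fun (congrArg (fun φ => appAt φ mid) h) ((0, x) : A × B)
      simp only [appAt_freeDesc_mid, map_zero, zero_add] at this
      exact this
    · have := LinearMap.congr_fun (congrArg (fun φ => appAt φ e) h) ((0, 0, 0, x) : A × A × B × C)
      simp only [appAt_freeDesc_e, map_zero, zero_add] at this
      exact this
  · rintro ⟨rfl, rfl, rfl⟩
    rfl

instance projective_free : Projective (free k A B C) where
  factors {Y Z} φ p _ := by
    obtain ⟨α, β, ε, rfl⟩ := exists_eq_freeDesc φ
    -- The sections need not commute with the arrows, since they are applied only to the generators.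
    have hp : ∀ x, ∃ s, appAt p x ∘ₗ s = LinearMap.id := fun x =>
      (appAt p x).exists_rightInverse_of_surjective
        (LinearMap.range_eq_top.2 (appAt_surjective_of_epi p x))
    choose s hs using hp
    refine ⟨freeDesc (s b ∘ₗ α) (s mid ∘ₗ β) (s e ∘ₗ ε), ?_⟩
    rw [freeDesc_comp, ← LinearMap.comp_assoc, ← LinearMap.comp_assoc, ← LinearMap.comp_assoc,
      hs, hs, hs]
    rfl

end Free

/-! ### The standard resolution and the computation of `Ext¹` -/

section Resolution

variable (X : QuiverRep k QOne)

/-- The free representation on the spaces of `X`. -/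
abbrev resolutionZero : QuiverRep k QOne :=
  free k (spaceAt X b) (spaceAt X mid) (spaceAt X e)

/-- The free representation on the sources of the arrows, placed at their targets. -/
abbrev resolutionOne : QuiverRep k QOne :=
  free k PUnit.{u + 1} (spaceAt X b) (spaceAt X b × spaceAt X mid)

/-- The canonical morphism from the free representation on `X` to `X`. -/
def resolutionπ : resolutionZero X ⟶ X :=
  freeDesc LinearMap.id LinearMap.id LinearMap.id

/-- The relations `a ⊗ x = 1 ⊗ X(a) x` for `a` an arrow, at `mid`. -/
def relationMid : spaceAt X b →ₗ[k] spaceAt X b × spaceAt X mid :=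
  LinearMap.prod LinearMap.id (-mapBM X)

/-- The relations `a ⊗ x = 1 ⊗ X(a) x` for `a` an arrow, at `e`. -/
def relationE : spaceAt X b × spaceAt X mid →ₗ[k]
    spaceAt X b × spaceAt X b × spaceAt X mid × spaceAt X e :=
  LinearMap.prod (LinearMap.fst k _ _) (LinearMap.prod 0 (LinearMap.prod (LinearMap.snd k _ _)
    (-LinearMap.coprod (mapBE X) (mapME X))))

/-- The inclusion of the relations in the free representation on `X`. -/
def resolutionι : resolutionOne X ⟶ resolutionZero X :=
  freeDesc (Y := resolutionZero X) 0 (relationMid X) (relationE X)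

lemma appAt_resolutionι_mid (x : PUnit × spaceAt X b) :
    appAt (resolutionι X) mid x = ((x.2, -mapBM X x.2) : spaceAt X b × spaceAt X mid) := by
  change LinearMap.inl k (spaceAt X b) (spaceAt X mid)
    ((0 : PUnit.{u + 1} →ₗ[k] spaceAt X b) x.1) + relationMid X x.2 = _
  simp [relationMid]

lemma appAt_resolutionι_e (x : PUnit × PUnit × spaceAt X b × spaceAt X b × spaceAt X mid) :
    appAt (resolutionι X) e x = ((x.2.2.2.1, x.2.2.1, x.2.2.2.2 - mapBM X x.2.2.1,
      -mapBE X x.2.2.2.1 - mapME X x.2.2.2.2) :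
      spaceAt X b × spaceAt X b × spaceAt X mid × spaceAt X e) := by
  change LinearMap.inl k (spaceAt X b) (spaceAt X b × spaceAt X mid × spaceAt X e)
    ((0 : PUnit.{u + 1} →ₗ[k] spaceAt X b) x.1) + (freeMapME (k := k) _ _ (spaceAt X e)
      (LinearMap.inl k (spaceAt X b) (spaceAt X mid)
        ((0 : PUnit.{u + 1} →ₗ[k] spaceAt X b) x.2.1)) +
    (freeMapME (k := k) _ _ (spaceAt X e) (relationMid X x.2.2.1) + relationE X x.2.2.2)) = _
  simp only [LinearMap.zero_apply, map_zero, zero_add, freeMapME, relationMid, relationE]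
  refine Prod.ext ?_ (Prod.ext ?_ (Prod.ext ?_ ?_))
  · simp
  · simp
  · simp [neg_add_eq_sub]
  · simp [sub_eq_add_neg, add_comm]

lemma resolutionι_comp_resolutionπ : resolutionι X ≫ resolutionπ X = 0 := by
  refine hom_ext_of_appAt (LinearMap.ext fun (x : PUnit) => ?_)
    (LinearMap.ext fun (x : PUnit × spaceAt X b) => ?_)
    (LinearMap.ext fun (x : PUnit × PUnit × spaceAt X b × spaceAt X b × spaceAt X mid) => ?_)
  · rfl
  · refine (congrArg (appAt (resolutionπ X) mid) (appAt_resolutionι_mid X x)).trans ?_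
    exact add_neg_cancel (mapBM X x.2)
  · refine (congrArg (appAt (resolutionπ X) e) (appAt_resolutionι_e X x)).trans ?_
    change mapBE X x.2.2.2.1 + (mapME X (mapBM X x.2.2.1) +
      (mapME X (x.2.2.2.2 - mapBM X x.2.2.1) + (-mapBE X x.2.2.2.1 - mapME X x.2.2.2.2))) = 0
    rw [map_sub]
    abel

theorem shortExact_resolution :
    (ShortComplex.mk (resolutionι X) (resolutionπ X) (resolutionι_comp_resolutionπ X)).ShortExact := by
  apply shortExact_of_appAt
  · intro x
    cases x
    · exact fun (x y : PUnit) _ => rfl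
    · intro (x : PUnit × spaceAt X b) (y : PUnit × spaceAt X b) h
      have h' : ((x.2, -mapBM X x.2) : spaceAt X b × spaceAt X mid) = (y.2, -mapBM X y.2) :=
        (appAt_resolutionι_mid X x).symm.trans (h.trans (appAt_resolutionι_mid X y))
      exact Prod.ext rfl (congrArg Prod.fst h')
    · intro (x : PUnit × PUnit × spaceAt X b × spaceAt X b × spaceAt X mid)
        (y : PUnit × PUnit × spaceAt X b × spaceAt X b × spaceAt X mid) h
      have h' : ((x.2.2.2.1, x.2.2.1, x.2.2.2.2 - mapBM X x.2.2.1,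
          -mapBE X x.2.2.2.1 - mapME X x.2.2.2.2) :
          spaceAt X b × spaceAt X b × spaceAt X mid × spaceAt X e) =
          (y.2.2.2.1, y.2.2.1, y.2.2.2.2 - mapBM X y.2.2.1,
          -mapBE X y.2.2.2.1 - mapME X y.2.2.2.2) :=
        (appAt_resolutionι_e X x).symm.trans (h.trans (appAt_resolutionι_e X y))
      simp only [Prod.mk.injEq] at h'
      obtain ⟨h₁, h₂, h₃, -⟩ := h'
      rw [h₂] at h₃
      exact Prod.ext rfl (Prod.ext rfl (Prod.ext h₂ (Prod.ext h₁ (sub_left_injective h₃))))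
  · intro x
    cases x
    · exact fun y => ⟨y, rfl⟩
    · refine fun (y : spaceAt X mid) => ⟨((0, y) : spaceAt X b × spaceAt X mid), ?_⟩
      change mapBM X 0 + y = y
      rw [map_zero, zero_add]
    · refine fun (y : spaceAt X e) =>
        ⟨((0, 0, 0, y) : spaceAt X b × spaceAt X b × spaceAt X mid × spaceAt X e), ?_⟩
      change mapBE X 0 + (mapME X (mapBM X 0) + (mapME X 0 + y)) = y
      simp only [map_zero, zero_add]
  · intro x
    cases x
    · intro y (hy : y = 0)
      exact ⟨PUnit.unit, hy.symm⟩
    · intro (y : spaceAt X b × spaceAt X mid) (hy : mapBM X y.1 + y.2 = 0)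
      refine ⟨((PUnit.unit, y.1) : PUnit × spaceAt X b), ?_⟩
      exact (appAt_resolutionι_mid X _).trans (Prod.ext rfl (neg_eq_of_add_eq_zero_right hy))
    · intro (y : spaceAt X b × spaceAt X b × spaceAt X mid × spaceAt X e)
        (hy : mapBE X y.1 + (mapME X (mapBM X y.2.1) + (mapME X y.2.2.1 + y.2.2.2)) = 0)
      refine ⟨((PUnit.unit, PUnit.unit, y.2.1, y.1, y.2.2.1 + mapBM X y.2.1) :
        PUnit × PUnit × spaceAt X b × spaceAt X b × spaceAt X mid), ?_⟩
      refine (appAt_resolutionι_e X _).trans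
        (Prod.ext rfl (Prod.ext rfl (Prod.ext (add_sub_cancel_right _ _) ?_)))
      change -mapBE X y.1 - mapME X (y.2.2.1 + mapBM X y.2.1) = y.2.2.2
      rw [← sub_eq_zero, ← neg_eq_zero, ← hy, map_add]
      abel

/-- By the universal property of free representations, composing with `resolutionι X` is `tripleMap`
up to sign (`key`), so the cokernel of `tripleMap` is `Ext¹(X, Y)`. -/
lemma exists_resolutionι_comp_iff (Y : QuiverRep k QOne) :
    (∀ φ : resolutionOne X ⟶ Y, ∃ ψ : resolutionZero X ⟶ Y, resolutionι X ≫ ψ = φ) ↔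
      Function.Surjective
        (tripleMap (mapBE X) (mapBM X) (mapME X) (mapBE Y) (mapBM Y) (mapME Y)) := by
  have key : ∀ (α : spaceAt X b →ₗ[k] spaceAt Y b) (β : spaceAt X mid →ₗ[k] spaceAt Y mid)
      (ε : spaceAt X e →ₗ[k] spaceAt Y e),
      resolutionι X ≫ freeDesc α β ε = freeDesc 0 (-(β ∘ₗ mapBM X - mapBM Y ∘ₗ α))
        (-LinearMap.coprod (ε ∘ₗ mapBE X - mapBE Y ∘ₗ α) (ε ∘ₗ mapME X - mapME Y ∘ₗ β)) := by
    intro α β ε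
    refine (freeDesc_comp _ _ _ _).trans (freeDesc_inj.2 ⟨LinearMap.comp_zero _,
      LinearMap.ext fun x => ?_, LinearMap.ext fun (x : spaceAt X b × spaceAt X mid) => ?_⟩)
    · change mapBM Y (α x) + β (-mapBM X x) = -(β (mapBM X x) - mapBM Y (α x))
      rw [map_neg]
      abel
    · change mapBE Y (α x.1) + (mapME Y (mapBM Y (α 0)) + (mapME Y (β x.2) +
        ε (-(mapBE X x.1 + mapME X x.2)))) = -((ε (mapBE X x.1) - mapBE Y (α x.1)) +
          (ε (mapME X x.2) - mapME Y (β x.2)))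
      simp only [map_zero, map_neg, map_add]
      abel
  constructor
  · rintro H ⟨φ, γ, η⟩
    obtain ⟨ψ, hψ⟩ := H (freeDesc 0 (-γ) (-LinearMap.coprod φ η))
    obtain ⟨α, β, ε, rfl⟩ := exists_eq_freeDesc ψ
    rw [key, freeDesc_inj, neg_inj, neg_inj] at hψ
    refine ⟨(α, β, ε), Prod.ext ?_ (Prod.ext hψ.2.1 ?_)⟩
    · have := congrArg (fun t => t ∘ₗ LinearMap.inl k _ _) hψ.2.2
      simp only [LinearMap.coprod_inl] at this
      exact this
    · have := congrArg (fun t => t ∘ₗ LinearMap.inr k _ _) hψ.2.2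
      simp only [LinearMap.coprod_inr] at this
      exact this
  · intro H φ
    obtain ⟨α, β, ε, rfl⟩ := exists_eq_freeDesc φ
    obtain ⟨⟨α', β', ε'⟩, h⟩ := H ((-ε) ∘ₗ LinearMap.inl k _ _, -β, (-ε) ∘ₗ LinearMap.inr k _ _)
    simp only [tripleMap, LinearMap.coe_mk, AddHom.coe_mk, Prod.mk.injEq] at h
    refine ⟨freeDesc α' β' ε', ?_⟩
    rw [key, h.1, h.2.1, h.2.2, freeDesc_inj, ← LinearMap.comp_coprod, LinearMap.coprod_inl_inr]
    refine ⟨Subsingleton.elim _ _, neg_neg _, ?_⟩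
    rw [LinearMap.comp_id, neg_neg]

end Resolution

theorem isExceptional_iff (X : QuiverRep k QOne) : IsExceptional k X ↔
    Module.finrank k (LinearMap.ker
      (tripleMap (mapBE X) (mapBM X) (mapME X) (mapBE X) (mapBM X) (mapME X))) = 1 ∧
    Function.Surjective (tripleMap (mapBE X) (mapBM X) (mapME X) (mapBE X) (mapBM X) (mapME X)) := by
  unfold IsExceptional
  rw [(homLinearEquiv X X).finrank_eq, ← exists_resolutionι_comp_iff]
  refine and_congr_right fun _ => ?_
  let _ : HasExt.{u + 1} (QuiverRep k QOne) := HasExt.standard _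
  have h1 := subsingleton_ext_one_iff (shortExact_resolution X) X
  constructor
  · intro H
    exact h1.1 (H 1 le_rfl)
  · intro H i hi
    obtain ⟨i, rfl⟩ := Nat.exists_eq_add_of_le' hi
    cases i with
    | zero => exact h1.2 H
    | succ n => exact subsingleton_ext_add_two (shortExact_resolution X) X n

end QOne

/-! ### The listed representations -/

namespace QOne

variable {k : Type u} [Field k]

lemma isExceptional_of_iso_mkRep {Vb Vmid Ve : Type u}
    [AddCommGroup Vb] [Module k Vb] [Module.Finite k Vb]
    [AddCommGroup Vmid] [Module k Vmid] [Module.Finite k Vmid]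
    [AddCommGroup Ve] [Module k Ve] [Module.Finite k Ve]
    {f : Vb →ₗ[k] Ve} {g : Vb →ₗ[k] Vmid} {h : Vmid →ₗ[k] Ve} {X : QuiverRep k QOne}
    (hX : Nonempty (X ≅ mkRep k f g h)) (hne : Nontrivial Vb ∨ Nontrivial Vmid ∨ Nontrivial Ve)
    (H : ∀ (α : Vb →ₗ[k] Vb) (β : Vmid →ₗ[k] Vmid) (ε : Ve →ₗ[k] Ve),
      ε ∘ₗ f = f ∘ₗ α → β ∘ₗ g = g ∘ₗ α → ε ∘ₗ h = h ∘ₗ β →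
      ∃ c : k, α = c • LinearMap.id ∧ β = c • LinearMap.id ∧ ε = c • LinearMap.id)
    (hd : Module.finrank k Vb * Module.finrank k Vb + Module.finrank k Vmid * Module.finrank k Vmid +
        Module.finrank k Ve * Module.finrank k Ve =
      Module.finrank k Vb * Module.finrank k Ve + Module.finrank k Vb * Module.finrank k Vmid +
        Module.finrank k Vmid * Module.finrank k Ve + 1) : IsExceptional k X := by
  have hb : Module.finrank k (LinearMap.ker
      (tripleMap (mapBE X) (mapBM X) (mapME X) (mapBE X) (mapBM X) (mapME X))) = 1 := by
    obtain ⟨i⟩ := hX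
    rw [← (homLinearEquiv X X).finrank_eq, (Linear.homCongr k i i).finrank_eq,
      (homLinearEquiv _ _).finrank_eq, mapBE_mkRep, mapBM_mkRep, mapME_mkRep]
    exact finrank_ker_eq_one_of_endomorphism_scalar hne H
  obtain ⟨p, q, r, -⟩ := (nonempty_iso_mkRep_iff f g h).1 hX
  refine (isExceptional_iff X).2 ⟨hb, (tripleMap_surjective_iff hb).2 ?_⟩
  rw [p.finrank_eq, q.finrank_eq, r.finrank_eq, hd]

theorem isExceptional_of_iso_listed [IsAlgClosed k] {X : QuiverRep k QOne} (i : Label)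
    (hX : Nonempty (X ≅ listed k i)) : IsExceptional k X := by
  cases i with
  | E₁ m =>
    refine isExceptional_of_iso_mkRep hX (.inl inferInstance) (fun α β ε h₁ h₂ h₃ => ?_) ?_
    -- The identity arrow identifies two components of the endomorphism, leaving an endomorphism of
    -- a Kronecker module; the same happens for the next three families.
    · obtain rfl : ε = β := h₃
      obtain ⟨c, h, h'⟩ := pi_endomorphism_scalar α ε h₁ h₂
      exact ⟨c, h, h', h'⟩
    · simp only [Module.finrank_fin_fun]; ring
  | E₂ m =>
    refine isExceptional_of_iso_mkRep hX (.inr (.inl inferInstance)) (fun α β ε h₁ h₂ h₃ => ?_) ?_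
    · obtain rfl : ε = β := h₃
      obtain ⟨c, h, h'⟩ := j_endomorphism_scalar α ε h₁ h₂
      exact ⟨c, h, h', h'⟩
    · simp only [Module.finrank_fin_fun]; ring
  | E₃ m =>
    refine isExceptional_of_iso_mkRep hX (.inr (.inr inferInstance)) (fun α β ε h₁ h₂ h₃ => ?_) ?_
    · obtain rfl : β = α := h₂
      obtain ⟨c, h, h'⟩ := j_endomorphism_scalar β ε h₁ h₃
      exact ⟨c, h, h, h'⟩
    · simp only [Module.finrank_fin_fun]; ring
  | E₄ m =>
    refine isExceptional_of_iso_mkRep hX (.inl inferInstance) (fun α β ε h₁ h₂ h₃ => ?_) ?_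
    · obtain rfl : β = α := h₂
      obtain ⟨c, h, h'⟩ := pi_endomorphism_scalar β ε h₁ h₃
      exact ⟨c, h, h, h'⟩
    · simp only [Module.finrank_fin_fun]; ring
  | M =>
    refine isExceptional_of_iso_mkRep hX (.inr (.inl inferInstance)) (fun α β ε h₁ h₂ h₃ => ?_) ?_
    · exact ⟨β 1, Subsingleton.elim _ _, by ext; simp, Subsingleton.elim _ _⟩
    · simp [Module.finrank_zero_of_subsingleton]
  | MPrime =>
    refine isExceptional_of_iso_mkRep hX (.inl inferInstance) (fun α β ε h₁ h₂ h₃ => ?_) ?_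
    · obtain rfl : ε = α := h₁
      exact ⟨ε 1, by ext; simp, Subsingleton.elim _ _, by ext; simp⟩
    · simp [Module.finrank_zero_of_subsingleton]

theorem exists_iso_listed_of_isExceptional {X : QuiverRep k QOne} (hX : IsExceptional k X) :
    ∃ i : Label, Nonempty (X ≅ listed k i) := by
  obtain ⟨hb, hs⟩ := (isExceptional_iff X).1 hX
  rcases tripleIso_of_rigid_brick hb hs with ⟨m, h⟩ | ⟨m, h⟩ | ⟨m, h⟩ | ⟨m, h⟩ | h | h
  · exact ⟨.E₁ m, (nonempty_iso_mkRep_iff _ _ _).2 h⟩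
  · exact ⟨.E₂ m, (nonempty_iso_mkRep_iff _ _ _).2 h⟩
  · exact ⟨.E₃ m, (nonempty_iso_mkRep_iff _ _ _).2 h⟩
  · exact ⟨.E₄ m, (nonempty_iso_mkRep_iff _ _ _).2 h⟩
  · exact ⟨.M, (nonempty_iso_mkRep_iff _ _ _).2 h⟩
  · exact ⟨.MPrime, (nonempty_iso_mkRep_iff _ _ _).2 h⟩

/-- The dimension vectors of the listed representations. -/
def Label.dim : Label → QOne → ℕ
  | .E₁ m, .b => m + 1
  | .E₁ m, _ => m
  | .E₂ m, .b => m
  | .E₂ m, _ => m + 1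
  | .E₃ m, .e => m + 1
  | .E₃ m, _ => m
  | .E₄ m, .e => m
  | .E₄ m, _ => m + 1
  | .M, .mid => 1
  | .M, _ => 0
  | .MPrime, .mid => 0
  | .MPrime, _ => 1

lemma finrank_spaceAt_listed (i : Label) (x : QOne) :
    Module.finrank k (spaceAt (listed k i) x) = i.dim x := by
  cases i <;> cases x <;> first
    | exact Module.finrank_fin_fun k
    | exact Module.finrank_self k
    | exact Module.finrank_zero_of_subsingleton (M := PUnit.{u + 1})

theorem eq_of_iso_listed {i j : Label} (h : Nonempty (listed k i ≅ listed k j)) : i = j := by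
  obtain ⟨p, q, r, -⟩ := nonempty_iso_iff.1 h
  have h₁ := p.finrank_eq
  have h₂ := q.finrank_eq
  have h₃ := r.finrank_eq
  rw [finrank_spaceAt_listed, finrank_spaceAt_listed] at h₁ h₂ h₃
  -- Distinct families never share a dimension vector; within one family, some vertex has dimension
  -- exactly `m`.
  cases i <;> cases j <;> simp only [Label.dim] at h₁ h₂ h₃ <;>
    first | rfl | omega | congr 1

end QOne

theorem mainTheorem5 (k : Type u) [Field k] [IsAlgClosed k] :
    (∀ X : QuiverRep k QOne,
      IsExceptional k X ↔ ∃ i : QOne.Label, Nonempty (X ≅ QOne.listed k i)) ∧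
    (∀ i j : QOne.Label, Nonempty (QOne.listed k i ≅ QOne.listed k j) → i = j) :=
  ⟨fun _ => ⟨QOne.exists_iso_listed_of_isExceptional,
    fun ⟨i, hi⟩ => QOne.isExceptional_of_iso_listed i hi⟩, fun _ _ => QOne.eq_of_iso_listed⟩
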